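/- Let $\Omega\subset\mathbb R^2$ be a bounded connected open set whose boundary is the disjoint union of $q$ piecewise smooth simple closed curves $\partial_1\Omega,\dots,\partial_q\Omega$ (with $\Omega$ lying locally on one side), of lengths $|\partial_\alpha\Omega|$, and let $|\partial\Omega|=\sum_\alpha|\partial_\alpha\Omega|$. Parametrize each $\partial_\alpha\Omega$ by arclength $s\in[0,|\partial_\alpha\Omega|)$ with respect to the positive orientation, from a chosen reference point. Let $\Phi$ be the phase space of the billiard map: its points are triples $z=(\alpha,s,\theta)$, with footpoint $p(z)\in\partial_\alpha\Omega$ of coordinate $s$ and $0<\theta<\pi$ the angle between the positive tangent and the direction of motion. Let $\varphi:\Phi\to\Phi$ be the billiard map (defined almost everywhere) and $d\nu=\sin\theta\,ds\,d\theta$ the Liouville measure, so $\nu(\Phi)=2|\partial\Omega|$. For $z\in\Phi$, $1\le\alpha\le q$ and $N\in\mathbb N$ let $0\le k_0<\dots<k_n\le N$ be the times $k\le N$ with $p(\varphi^{k}(z))\in\partial_\alpha\Omega$, let $s_i\in[0,|\partial_\alpha\Omega|)$ be the coordinate of $p(\varphi^{k_i}(z))$, and let $\xi_i\in[0,|\partial_\alpha\Omega|)$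 be the number with $s_i+\xi_i=s_{i+1}$ or $s_i+\xi_i=s_{i+1}+|\partial_\alpha\Omega|$. Put $$\upsilon_\alpha(z)=\lim_{N\to\infty}\frac{\xi_0+\dots+\xi_{n-1}}{N},\qquad \vec\rho(z)=\Bigl(\frac{\upsilon_1(z)}{|\partial_1\Omega|},\dots,\frac{\upsilon_q(z)}{|\partial_q\Omega|}\Bigr).$$ Let $R_\alpha\subset\Phi$ be the set of phase points $z$ with $p(z)\in\partial_\alpha\Omega$ for which the next visit of the orbit to $\partial_\alpha\Omega$ occurs at the same point $p(z)$. Then these limits exist for $\nu$-almost all $z$, the functions $\upsilon_\alpha$ are $\nu$-integrable, and for every $\alpha$ $$\int_\Phi\upsilon_\alpha\,d\nu=|\partial_\alpha\Omega|^2-\tfrac12|\partial_\alpha\Omega|\,\nu(R_\alpha).$$ Consequently, if almost surely consecutive visits to a boundary component occur at different points, i.e. $\nu(R_\alpha)=0$ for all $\alpha$, then $\int_\Phi\upsilon_\alpha\,d\nu=|\partial_\alpha\Omega|^2$ for every $\alpha$, and the mean rotation vector is $$\frac{\int_\Phi\vec\rho\,d\nu}{\nu(\Phi)}=\frac12\Bigl(\frac{|\partial_1\Omega|}{|\partial\Omega|},\dots,\frac{|\partial_q\Omega|}{|\partial\Omega|}\Bigr);$$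 if, moreover, the billiard is ergodic, then $\vec\rho(z)$ equals this vector for $\nu$-almost all $z\in\Phi$. -/

import Mathlib

open Filter Topology MeasureTheory

noncomputable section

/-- A bounded `q`-connected planar domain with piecewise smooth boundary, together with a choice of
reference points on the boundary components.  The plane is `ℂ`.  The boundary is the disjoint union
of `q` simple closed curves; the curve `α` is the image of `γ α`, an `L α`-periodic parametrization
by arclength with respect to the positive orientation (the domain is on the left, and only there).
Smoothness of the pieces is asked only in the weakest sense (`C¹` away from finitely many corners of
each curve), so that tables with `C^k` or `C^∞` pieces are all included. -/
structure BilliardTable (q : ℕ) where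
  /-- the domain -/
  Ω : Set ℂ
  isOpen : IsOpen Ω
  isConnected : IsConnected Ω
  isBounded : Bornology.IsBounded Ω
  /-- the lengths of the boundary components -/
  L : Fin q → ℝ
  L_pos : ∀ α, 0 < L α
  /-- the arclength parametrizations of the boundary components -/
  γ : Fin q → ℝ → ℂ
  continuous : ∀ α, Continuous (γ α)
  periodic : ∀ α, Function.Periodic (γ α) (L α)
  injOn : ∀ α, Set.InjOn (γ α) (Set.Ico 0 (L α))
  disjoint : Pairwise fun α β => Disjoint (Set.range (γ α)) (Set.range (γ β))
  frontier_eq : frontier Ω = ⋃ α, Set.range (γ α)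
  finite_corners : ∀ α, {s ∈ Set.Ico 0 (L α) | ¬ ContDiffAt ℝ 1 (γ α) s}.Finite
  unit_speed : ∀ α s, ContDiffAt ℝ 1 (γ α) s → ‖deriv (γ α) s‖ = 1
  left_mem : ∀ α s, ContDiffAt ℝ 1 (γ α) s →
    ∀ᶠ t : ℝ in 𝓝[>] 0, γ α s + t * (Complex.I * deriv (γ α) s) ∈ Ω
  right_notMem : ∀ α s, ContDiffAt ℝ 1 (γ α) s →
    ∀ᶠ t : ℝ in 𝓝[>] 0, γ α s - t * (Complex.I * deriv (γ α) s) ∉ Ω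

namespace BilliardTable

variable {q : ℕ} (T : BilliardTable q)

/-- The perimeter `|∂Ω|`. -/
def perimeter : ℝ := ∑ α, T.L α

/-- The phase space: triples `(α, s, θ)`, where `α` is the boundary component of the footpoint, `s`
its arclength coordinate, and `θ` the angle between the positive tangent and the velocity. -/
def phaseSpace : Set (Fin q × ℝ × ℝ) :=
  {z | z.2.1 ∈ Set.Ico 0 (T.L z.1) ∧ z.2.2 ∈ Set.Ioo 0 Real.pi}

/-- The Liouville measure `dν = sin θ ds dθ` on the phase space. -/
def liouville : Measure (Fin q × ℝ × ℝ) :=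
  ((Measure.count.prod (volume.prod volume)).restrict T.phaseSpace).withDensity
    fun z => ENNReal.ofReal (Real.sin z.2.2)

/-- The footpoint of a phase point. -/
def footpoint (z : Fin q × ℝ × ℝ) : ℂ := T.γ z.1 z.2.1

/-- The boundary is smooth at the footpoint. -/
def IsRegular (z : Fin q × ℝ × ℝ) : Prop := ContDiffAt ℝ 1 (T.γ z.1) z.2.1

/-- The unit vector at the footpoint that makes the angle `θ` with the positive tangent. -/
def direction (z : Fin q × ℝ × ℝ) (θ : ℝ) : ℂ :=
  Complex.exp (θ * Complex.I) * deriv (T.γ z.1) z.2.1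

/-- `w` is the phase point that follows `z`: the ray from the footpoint of `z` in the direction of
`z` runs inside `Ω` up to the footpoint of `w`, arrives there with the angle `-θ` to the positive
tangent, and leaves with the angle `θ` (angle of incidence equals angle of reflection). -/
def IsNext (z w : Fin q × ℝ × ℝ) : Prop :=
  z ∈ T.phaseSpace ∧ w ∈ T.phaseSpace ∧ T.IsRegular z ∧ T.IsRegular w ∧
  (∃ t : ℝ, 0 < t ∧ T.footpoint w = T.footpoint z + t * T.direction z z.2.2 ∧
    ∀ r ∈ Set.Ioo 0 t, T.footpoint z + r * T.direction z z.2.2 ∈ T.Ω) ∧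
  T.direction z z.2.2 = T.direction w (-w.2.2)

open Classical in
/-- The billiard map.  It is the identity at the (Liouville-null) set of points of the phase space
that have no successor: those at a corner and those whose ray runs into a corner or is tangent to
the boundary where it first meets it. -/
def billiardMap (z : Fin q × ℝ × ℝ) : Fin q × ℝ × ℝ :=
  if h : ∃ w, T.IsNext z w then h.choose else z

/-- The number `0 ≤ ξ < L` with `s + ξ = s'` or `s + ξ = s' + L`, for `0 ≤ s, s' < L`. -/
def increment (L s s' : ℝ) : ℝ := if s ≤ s' then s' - s else s' + L - s

/-- At time `k`, the orbit of `z` has its footpoint on the boundary component `α`. -/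
def Visits (α : Fin q) (z : Fin q × ℝ × ℝ) (k : ℕ) : Prop := (T.billiardMap^[k] z).1 = α

/-- The times `k < l` are consecutive visits of the orbit of `z` to the boundary component `α`. -/
def ConsecutiveVisits (α : Fin q) (z : Fin q × ℝ × ℝ) (k l : ℕ) : Prop :=
  k < l ∧ T.Visits α z k ∧ T.Visits α z l ∧ ∀ j, k < j → j < l → ¬ T.Visits α z j

open Classical in
/-- The sum `ξ₀ + ⋯ + ξₙ₋₁` of the increments over all pairs of consecutive visits to `α` up to
time `N`. -/
def totalIncrement (α : Fin q) (z : Fin q × ℝ × ℝ) (N : ℕ) : ℝ :=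
  ∑ k ∈ Finset.range (N + 1), ∑ l ∈ Finset.range (N + 1),
    if T.ConsecutiveVisits α z k l then
      increment (T.L α) (T.billiardMap^[k] z).2.1 (T.billiardMap^[l] z).2.1
    else 0

/-- The limit that defines the `α`-component of the footpoint gain vector exists and is `u`. -/
def HasFootpointGain (α : Fin q) (z : Fin q × ℝ × ℝ) (u : ℝ) : Prop :=
  Tendsto (fun N : ℕ => T.totalIncrement α z N / N) atTop (𝓝 u)

/-- The footpoint gain vector (meaningful where the limits exist). -/
def footpointGain (z : Fin q × ℝ × ℝ) : Fin q → ℝ :=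
  fun α => limUnder atTop fun N : ℕ => T.totalIncrement α z N / N

/-- The rotation vector. -/
def rotationVector (z : Fin q × ℝ × ℝ) : Fin q → ℝ :=
  fun α => T.footpointGain z α / T.L α

/-- The phase points on the boundary component `α` whose next visit to `α` has the same footpoint. -/
def closedReturns (α : Fin q) : Set (Fin q × ℝ × ℝ) :=
  {z | ∃ n, T.ConsecutiveVisits α z 0 n ∧ (T.billiardMap^[n] z).2.1 = z.2.1}

/-- The billiard is ergodic: every measurable invariant set is null or has null complement. -/
def IsErgodic : Prop := PreErgodic T.billiardMap T.liouville

end BilliardTable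

end

/-! Let `gain α z` be the arclength increment from a visit `z` to `α` to the next visit, and `0`
where there is none. Up to time `N` the total increment differs from the Birkhoff sum of `gain α` by
at most `L α` (`abs_totalIncrement_sub_le`). Hence the pointwise ergodic theorem, proved here for
bounded functions by the maximal inequality, yields the limits, and their integral is that of `gain
α` (`integral_gain`).

That integral comes from time reversal. On the set of points that first return to `α` at time `n`,
the map `K`, `n` steps of the billiard followed by the reversal `flip`, is almost everywhere a
measure-preserving involution. It exchanges the two footpoints, so if they differ then the two gains
are complementary arcs: `gain α z + gain α (K z) = L α`. The mean gain is therefore `L α / 2` off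
the closed returns, and it is `0` on them. By Poincaré recurrence almost every point of the
component returns, and the component has mass `2 * L α`; so the integral is `L α / 2` times `2 * L
α` minus the mass of the closed returns.

All this needs invariance of the Liouville measure, for boundary pieces that are only `C¹`. In the
coordinates angle and offset on the space of unoriented lines, the Liouville measure is the area
(`liouville_eq_volume_line_image`). The billiard map is `flip` after `lookBack`, and `lookBack`
passes to the other end of the same chord, so it does not change the line. Lines rarely determine
the phase point globally, hence the cutting into countably many pieces. For each angle, the offsets
of lines through corners or tangencies are null by a one-dimensional Sard argument, so the map is
defined almost everywhere. -/

noncomputable section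

/-! ### The pointwise ergodic theorem for bounded functions -/

section Birkhoff

set_option linter.unusedSectionVars false

variable {X : Type*} [MeasurableSpace X] {μ : Measure X} {T : X → X} {g : X → ℝ}

/-- The largest of the first `n` Birkhoff sums (including the empty one), defined recursively. -/
def maxBirkhoffSum (T : X → X) (g : X → ℝ) : ℕ → X → ℝ
  | 0 => fun _ => 0
  | n + 1 => fun x => max 0 (g x + maxBirkhoffSum T g n (T x))

theorem maxBirkhoffSum_nonneg (n : ℕ) (x : X) : 0 ≤ maxBirkhoffSum T g n x := by
  cases n with
  | zero => exact le_rfl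
  | succ n => exact le_max_left _ _

theorem maxBirkhoffSum_le_succ (n : ℕ) (x : X) :
    maxBirkhoffSum T g n x ≤ maxBirkhoffSum T g (n + 1) x := by
  induction n generalizing x with
  | zero => exact maxBirkhoffSum_nonneg 1 x
  | succ n ih => exact max_le_max le_rfl (by gcongr; exact ih (T x))

theorem birkhoffSum_le_maxBirkhoffSum (n : ℕ) (x : X) :
    birkhoffSum T g n x ≤ maxBirkhoffSum T g n x := by
  induction n generalizing x with
  | zero => simp [maxBirkhoffSum]
  | succ n ih =>
    rw [birkhoffSum_succ']
    exact (by gcongr; exact ih (T x) : _ ≤ g x + maxBirkhoffSum T g n (T x)).trans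
      (le_max_right _ _)

theorem measurable_maxBirkhoffSum (hT : Measurable T) (hg : Measurable g) (n : ℕ) :
    Measurable (maxBirkhoffSum T g n) := by
  induction n with
  | zero => exact measurable_const
  | succ n ih => exact measurable_const.max (hg.add (ih.comp hT))

theorem integrable_maxBirkhoffSum (hT : MeasurePreserving T μ μ) (hg : Integrable g μ) (n : ℕ) :
    Integrable (maxBirkhoffSum T g n) μ := by
  induction n with
  | zero => exact integrable_zero _ _ _
  | succ n ih =>
    exact (integrable_zero X ℝ μ).sup (hg.add (hT.integrable_comp_of_integrable ih))

/-- Garsia's inequality. Where the maximum is positive it is not attained by the empty sum, so it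
equals `g` plus a shorter maximum at `T x`; elsewhere it is `0` and the left side is nonpositive. -/
theorem maxBirkhoffSum_sub_le (n : ℕ) (x : X) :
    maxBirkhoffSum T g n x - maxBirkhoffSum T g n (T x) ≤
      {y | 0 < maxBirkhoffSum T g n y}.indicator g x := by
  by_cases h : 0 < maxBirkhoffSum T g n x
  · rw [Set.indicator_of_mem (by exact h)]
    cases n with
    | zero => exact absurd h (lt_irrefl _)
    | succ n =>
      have h1 : maxBirkhoffSum T g (n + 1) x = g x + maxBirkhoffSum T g n (T x) := by
        rcases le_total (g x + maxBirkhoffSum T g n (T x)) 0 with h2 | h2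
        · exact absurd h (not_lt.2 (max_le le_rfl h2))
        · exact max_eq_right h2
      have := maxBirkhoffSum_le_succ (T := T) (g := g) n (T x)
      linarith
  · rw [Set.indicator_of_notMem (by exact h)]
    have := maxBirkhoffSum_nonneg (T := T) (g := g) n (T x)
    linarith

/-- The maximal ergodic theorem. -/
theorem integral_nonneg_of_exists_birkhoffSum_pos (hT : MeasurePreserving T μ μ)
    (hgm : Measurable g) (hg : Integrable g μ) (h : ∀ᵐ x ∂μ, ∃ n, 0 < birkhoffSum T g n x) :
    0 ≤ ∫ x, g x ∂μ := by
  have hms : ∀ n, MeasurableSet {y | 0 < maxBirkhoffSum T g n y} := fun n =>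
    measurableSet_lt measurable_const (measurable_maxBirkhoffSum hT.measurable hgm n)
  have hpos : ∀ n, 0 ≤ ∫ x, {y | 0 < maxBirkhoffSum T g n y}.indicator g x ∂μ := by
    intro n
    have hi := integrable_maxBirkhoffSum hT hg n
    have hi' := hT.integrable_comp_of_integrable hi
    have h0 : ∫ x, (maxBirkhoffSum T g n x - maxBirkhoffSum T g n (T x)) ∂μ = 0 := by
      have := integral_sub hi hi'
      simp only [Function.comp_apply] at this
      rw [this, sub_eq_zero]
      have h2 := integral_map (μ := μ) hT.measurable.aemeasurable
        (f := maxBirkhoffSum T g n) (by rw [hT.map_eq]; exact hi.1)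
      rwa [hT.map_eq] at h2
    exact h0.symm.le.trans
      (integral_mono (hi.sub hi') (hg.indicator (hms n)) (maxBirkhoffSum_sub_le n))
  -- The sets where the maxima are positive increase to a set of full measure, so the indicators of
  -- `g` on them converge to `g`.
  refine ge_of_tendsto' (tendsto_integral_of_dominated_convergence (fun x => ‖g x‖)
    (fun n => (hg.indicator (hms n)).1) hg.norm
    (fun n => Eventually.of_forall fun x => norm_indicator_le_norm_self _ _) ?_) hpos
  filter_upwards [h] with x ⟨n, hn⟩
  refine tendsto_const_nhds.congr' ?_
  filter_upwards [eventually_ge_atTop n] with m hm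
  rw [Set.indicator_of_mem]
  exact (hn.trans_le (birkhoffSum_le_maxBirkhoffSum n x)).trans_le
    (monotone_nat_of_le_succ (f := fun n => maxBirkhoffSum T g n x)
      (fun n => maxBirkhoffSum_le_succ n x) hm)

theorem measurable_birkhoffAverage (hT : Measurable T) (hg : Measurable g) (n : ℕ) :
    Measurable (birkhoffAverage ℝ T g n) := by
  have : Measurable fun x => ∑ k ∈ Finset.range n, g (T^[k] x) :=
    Finset.measurable_sum _ fun k _ => hg.comp (hT.iterate k)
  exact this.const_mul ((n : ℝ)⁻¹)

theorem abs_birkhoffAverage_le {C : ℝ} (hC : ∀ x, |g x| ≤ C) (n : ℕ) (x : X) :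
    |birkhoffAverage ℝ T g n x| ≤ C := by
  have hC0 : 0 ≤ C := (abs_nonneg _).trans (hC x)
  rcases n.eq_zero_or_pos with rfl | hn
  · simpa using hC0
  · have hn' : (0 : ℝ) < n := by exact_mod_cast hn
    rw [birkhoffAverage, smul_eq_mul, abs_mul, abs_of_pos (inv_pos.2 hn'), inv_mul_le_iff₀ hn',
      birkhoffSum]
    refine (Finset.abs_sum_le_sum_abs _ _).trans ((Finset.sum_le_sum fun k _ => hC _).trans ?_)
    simp

theorem isBoundedUnder_birkhoffAverage {C : ℝ} (hC : ∀ x, |g x| ≤ C) (x : X) :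
    IsBoundedUnder (· ≤ ·) atTop (fun n => birkhoffAverage ℝ T g n x) ∧
    IsBoundedUnder (· ≥ ·) atTop (fun n => birkhoffAverage ℝ T g n x) :=
  ⟨isBoundedUnder_of ⟨C, fun n => (abs_le.1 (abs_birkhoffAverage_le hC n x)).2⟩,
    isBoundedUnder_of ⟨-C, fun n => (abs_le.1 (abs_birkhoffAverage_le hC n x)).1⟩⟩

theorem tendsto_birkhoffAverage_comp_sub {C : ℝ} (hC : ∀ x, |g x| ≤ C) (x : X) :
    Tendsto (fun n => birkhoffAverage ℝ T g n (T x) - birkhoffAverage ℝ T g n x) atTop (𝓝 0) := by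
  refine tendsto_birkhoffAverage_apply_sub_birkhoffAverage' ℝ ?_ T x
  refine (Metric.isBounded_closedBall (x := (0 : ℝ)) (r := C)).subset ?_
  rintro _ ⟨y, rfl⟩
  simpa using hC y

theorem limsup_le_limsup_of_tendsto_sub {u v : ℕ → ℝ}
    (hu' : IsBoundedUnder (· ≥ ·) atTop u)
    (hv : IsBoundedUnder (· ≤ ·) atTop v) (hv' : IsBoundedUnder (· ≥ ·) atTop v)
    (h : Tendsto (fun n => v n - u n) atTop (𝓝 0)) : limsup u atTop ≤ limsup v atTop := by
  rw [le_limsup_iff hv'.isCoboundedUnder_le hv]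
  intro c hc
  obtain ⟨d, hcd, hd⟩ := exists_between hc
  have h1 := frequently_lt_of_lt_limsup hu'.isCoboundedUnder_le hd
  have h2 := h.eventually (lt_mem_nhds (show c - d < 0 by linarith))
  exact (h1.and_eventually h2).mono fun n hn => by linarith [hn.1, hn.2]

theorem limsup_birkhoffAverage_comp {C : ℝ} (hC : ∀ x, |g x| ≤ C) (x : X) :
    limsup (fun n => birkhoffAverage ℝ T g n (T x)) atTop =
      limsup (fun n => birkhoffAverage ℝ T g n x) atTop := by
  have h := tendsto_birkhoffAverage_comp_sub (T := T) hC x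
  have b := isBoundedUnder_birkhoffAverage (T := T) hC
  refine le_antisymm (limsup_le_limsup_of_tendsto_sub (b _).2 (b _).1 (b _).2 ?_)
    (limsup_le_limsup_of_tendsto_sub (b _).2 (b _).1 (b _).2 h)
  simpa using h.neg

/-- The maximal ergodic theorem for `g - d` on the invariant set `A`: a limsup above `d` forces some
Birkhoff sum of `g - d` to be positive. -/
theorem mul_measureReal_le_setIntegral_of_lt_limsup [IsFiniteMeasure μ]
    (hT : MeasurePreserving T μ μ) (hgm : Measurable g) {C d : ℝ} (hC : ∀ x, |g x| ≤ C) {A : Set X}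
    (hA : MeasurableSet A) (hTA : T ⁻¹' A = A)
    (hd : ∀ x ∈ A, d < limsup (fun n => birkhoffAverage ℝ T g n x) atTop) :
    d * μ.real A ≤ ∫ x in A, g x ∂μ := by
  have hT' : MeasurePreserving T (μ.restrict A) (μ.restrict A) := by
    have := hT.restrict_preimage hA
    rwa [hTA] at this
  have hgi : Integrable g (μ.restrict A) :=
    Integrable.of_bound hgm.aestronglyMeasurable C (Eventually.of_forall hC)
  have h := integral_nonneg_of_exists_birkhoffSum_pos hT' (hgm.sub_const d)
    (hgi.sub (integrable_const d)) ?_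
  · rw [integral_sub hgi (integrable_const d), integral_const] at h
    simp only [measureReal_restrict_apply_univ, smul_eq_mul] at h
    linarith
  · refine (ae_restrict_iff' hA).2 (Eventually.of_forall fun x hx => ?_)
    have hf := frequently_lt_of_lt_limsup
      (isBoundedUnder_birkhoffAverage hC x).2.isCoboundedUnder_le (hd x hx)
    obtain ⟨n, hn, hn0⟩ := (hf.and_eventually (eventually_gt_atTop 0)).exists
    refine ⟨n, ?_⟩
    have hn' : (0 : ℝ) < n := by exact_mod_cast hn0
    rw [birkhoffAverage, smul_eq_mul, lt_inv_mul_iff₀ hn'] at hn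
    simp only [birkhoffSum] at hn ⊢
    rw [Finset.sum_sub_distrib]
    simpa using hn

/-- The pointwise ergodic theorem for bounded functions. -/
theorem ae_exists_tendsto_birkhoffAverage [IsFiniteMeasure μ] (hT : MeasurePreserving T μ μ)
    (hgm : Measurable g) {C : ℝ} (hC : ∀ x, |g x| ≤ C) :
    ∀ᵐ x ∂μ, ∃ u, Tendsto (fun n => birkhoffAverage ℝ T g n x) atTop (𝓝 u) := by
  have hC' : ∀ x, |(-g) x| ≤ C := fun x => by simpa using hC x
  have key : ∀ a b : ℝ, a < b → ∀ᵐ x ∂μ, ¬ (b ≤ limsup (fun n => birkhoffAverage ℝ T g n x) atTop ∧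
      -a ≤ limsup (fun n => birkhoffAverage ℝ T (-g) n x) atTop) := by
    intro a b hab
    set A := {x | b ≤ limsup (fun n => birkhoffAverage ℝ T g n x) atTop ∧
      -a ≤ limsup (fun n => birkhoffAverage ℝ T (-g) n x) atTop} with hAdef
    have hA : MeasurableSet A :=
      (measurableSet_le measurable_const
        (Measurable.limsup fun n => measurable_birkhoffAverage hT.measurable hgm n)).inter
      (measurableSet_le measurable_const
        (Measurable.limsup fun n => measurable_birkhoffAverage hT.measurable hgm.neg n))
    have hTA : T ⁻¹' A = A := by
      ext x
      simp only [hAdef, Set.mem_preimage, Set.mem_ofPred_eq]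
      rw [limsup_birkhoffAverage_comp hC, limsup_birkhoffAverage_comp hC']
    -- The margin `(b - a) / 3` makes the inequalities strict. Used twice, it still leaves a third
    -- of the gap when the bounds for `g` and `-g` are added.
    have h1 := mul_measureReal_le_setIntegral_of_lt_limsup (d := b - (b - a) / 3) hT hgm hC hA hTA
      fun x hx => by linarith [hx.1]
    have h2 := mul_measureReal_le_setIntegral_of_lt_limsup (d := -a - (b - a) / 3) hT hgm.neg hC'
      hA hTA fun x hx => by linarith [hx.2]
    simp only [Pi.neg_apply, integral_neg] at h2
    have h3 : μ.real A = 0 := by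
      refine le_antisymm ?_ measureReal_nonneg
      have : (b - a) / 3 * μ.real A ≤ 0 := by linarith
      exact nonpos_of_mul_nonpos_right this (by linarith)
    exact measure_eq_zero_iff_ae_notMem.1 ((measureReal_eq_zero_iff).1 h3)
  have key' : ∀ᵐ x ∂μ, ∀ a b : ℚ, (a : ℝ) < b →
      ¬ (b ≤ limsup (fun n => birkhoffAverage ℝ T g n x) atTop ∧
        -(a : ℝ) ≤ limsup (fun n => birkhoffAverage ℝ T (-g) n x) atTop) :=
    ae_all_iff.2 fun a => ae_all_iff.2 fun b => by
      by_cases hab : (a : ℝ) < b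
      · filter_upwards [key a b hab] with x hx _ using hx
      · exact Eventually.of_forall fun x h => absurd h hab
  filter_upwards [key'] with x hx
  refine tendsto_of_no_upcrossings (Rat.denseRange_cast (𝕜 := ℝ)) ?_
    (isBoundedUnder_birkhoffAverage hC x).1 (isBoundedUnder_birkhoffAverage hC x).2
  rintro _ ⟨a, rfl⟩ _ ⟨b, rfl⟩ hab ⟨h1, h2⟩
  refine hx a b hab ⟨le_limsup_of_frequently_le (h2.mono fun n hn => hn.le)
    (isBoundedUnder_birkhoffAverage hC x).1, le_limsup_of_frequently_le (h1.mono fun n hn => ?_)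
    (isBoundedUnder_birkhoffAverage hC' x).1⟩
  rw [birkhoffAverage_neg]
  exact neg_le_neg hn.le

theorem integral_birkhoffAverage [IsFiniteMeasure μ] (hT : MeasurePreserving T μ μ)
    (hgm : Measurable g) {C : ℝ} (hC : ∀ x, |g x| ≤ C) {n : ℕ} (hn : n ≠ 0) :
    ∫ x, birkhoffAverage ℝ T g n x ∂μ = ∫ x, g x ∂μ := by
  have hgi : Integrable g μ :=
    Integrable.of_bound hgm.aestronglyMeasurable C (Eventually.of_forall hC)
  simp only [birkhoffAverage, birkhoffSum, smul_eq_mul]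
  rw [integral_const_mul, integral_finsetSum]
  · have : ∀ k ∈ Finset.range n, ∫ x, g (T^[k] x) ∂μ = ∫ x, g x ∂μ := fun k _ => by
      have h2 := integral_map (μ := μ) (hT.iterate k).measurable.aemeasurable
        (f := g) hgm.aestronglyMeasurable
      rw [← h2, (hT.iterate k).map_eq]
    rw [Finset.sum_congr rfl this]
    simp [hn]
  · exact fun k _ => (hT.iterate k).integrable_comp_of_integrable hgi

/-- The limit of the Birkhoff averages has the same integral as the function. -/
theorem integrable_and_integral_eq_of_tendsto_birkhoffAverage [IsFiniteMeasure μ]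
    (hT : MeasurePreserving T μ μ) (hgm : Measurable g) {C : ℝ} (hC : ∀ x, |g x| ≤ C) {h : X → ℝ}
    (hh : ∀ᵐ x ∂μ, Tendsto (fun n => birkhoffAverage ℝ T g n x) atTop (𝓝 (h x))) :
    Integrable h μ ∧ ∫ x, h x ∂μ = ∫ x, g x ∂μ := by
  have hm : ∀ n, AEStronglyMeasurable (birkhoffAverage ℝ T g n) μ := fun n =>
    (measurable_birkhoffAverage hT.measurable hgm n).aestronglyMeasurable
  have hb : ∀ n, ∀ᵐ x ∂μ, ‖birkhoffAverage ℝ T g n x‖ ≤ C := fun n =>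
    Eventually.of_forall fun x => abs_birkhoffAverage_le hC n x
  refine ⟨Integrable.of_bound (aestronglyMeasurable_of_tendsto_ae atTop hm hh) C ?_, ?_⟩
  · filter_upwards [hh] with x hx
    exact le_of_tendsto' hx.norm fun n => abs_birkhoffAverage_le hC n x
  · refine tendsto_nhds_unique
      (tendsto_integral_of_dominated_convergence (fun _ => C) hm (integrable_const C) hb hh)
      (tendsto_const_nhds.congr' ?_)
    filter_upwards [eventually_ne_atTop 0] with n hn
    exact (integral_birkhoffAverage hT hgm hC hn).symm

end Birkhoff

/-! ### The boundary near a smooth point -/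

namespace BilliardTable

variable {q : ℕ} (T : BilliardTable q)

theorem γ_eq_γ_iff {α : Fin q} {s t : ℝ} : T.γ α s = T.γ α t ↔ ∃ n : ℤ, t - s = n • T.L α := by
  have key : ∀ x, T.γ α (toIcoMod (T.L_pos α) 0 x) = T.γ α x := fun x =>
    (T.periodic α).sub_zsmul_eq _
  have mem : ∀ x, toIcoMod (T.L_pos α) 0 x ∈ Set.Ico 0 (T.L α) := fun x => by
    simpa using toIcoMod_mem_Ico (T.L_pos α) 0 x
  rw [← toIcoMod_eq_toIcoMod (T.L_pos α) (a := 0)]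
  constructor
  · intro h
    exact T.injOn α (mem s) (mem t) (by rw [key, key, h])
  · intro h
    rw [← key s, h, key t]

theorem isCompact_range_γ (α : Fin q) : IsCompact (Set.range (T.γ α)) :=
  (T.periodic α).compact_of_continuous (T.L_pos α).ne' (T.continuous α)

theorem hasDerivAt_of_contDiffAt {α : Fin q} {s : ℝ} (h : ContDiffAt ℝ 1 (T.γ α) s) :
    HasDerivAt (T.γ α) (deriv (T.γ α) s) s :=
  (h.differentiableAt (by simp)).hasDerivAt

theorem mul_conj_deriv_self {α : Fin q} {s : ℝ} (h : ContDiffAt ℝ 1 (T.γ α) s) :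
    deriv (T.γ α) s * (starRingEnd ℂ) (deriv (T.γ α) s) = 1 := by
  rw [Complex.mul_conj, Complex.normSq_eq_norm_sq, T.unit_speed α s h]
  simp

theorem abs_im_mul_conj_deriv_le {α : Fin q} {s : ℝ} (h : ContDiffAt ℝ 1 (T.γ α) s) (z : ℂ) :
    |(z * (starRingEnd ℂ) (deriv (T.γ α) s)).im| ≤ ‖z‖ := by
  refine (Complex.abs_im_le_norm _).trans ?_
  rw [norm_mul, RCLike.norm_conj, T.unit_speed α s h, mul_one]

/-- Near the parameter of a smooth boundary point, the curve is close to its tangent. -/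
theorem eventually_abs_im_γ_le {α : Fin q} {s : ℝ} (h : ContDiffAt ℝ 1 (T.γ α) s) {c : ℝ}
    (hc : 0 < c) : ∀ᶠ t in 𝓝 s,
      |((T.γ α t - T.γ α s) * (starRingEnd ℂ) (deriv (T.γ α) s)).im| ≤
        c * ‖T.γ α t - T.γ α s‖ := by
  set e := deriv (T.γ α) s with he
  -- The bound `1 / 2` on the relative error gives `|t - s| ≤ 2 * ‖d‖`; with it the bound `c / 2`
  -- becomes `c * ‖d‖`.
  have hd := (hasDerivAt_iff_isLittleO.1 (T.hasDerivAt_of_contDiffAt h)).def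
    (show 0 < min (c / 2) (1 / 2) by positivity)
  filter_upwards [hd] with t ht
  set d := T.γ α t - T.γ α s
  rw [← he, Real.norm_eq_abs] at ht
  clear_value d
  have h1 : ‖d - (t - s) • e‖ ≤ c / 2 * |t - s| :=
    ht.trans (by gcongr; exact min_le_left _ _)
  have h2 : ‖d - (t - s) • e‖ ≤ 1 / 2 * |t - s| :=
    ht.trans (by gcongr; exact min_le_right _ _)
  have h3 : ‖(t - s) • e‖ = |t - s| := by
    rw [norm_smul, he, T.unit_speed α s h, mul_one, Real.norm_eq_abs]
  have h4 : |t - s| ≤ 2 * ‖d‖ := by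
    have := norm_sub_norm_le ((t - s) • e) d
    rw [norm_sub_rev _ d] at this
    linarith
  have h5 : (d * (starRingEnd ℂ) e).im = ((d - (t - s) • e) * (starRingEnd ℂ) e).im := by
    rw [sub_mul, smul_mul_assoc, T.mul_conj_deriv_self h]
    simp
  rw [h5]
  refine (T.abs_im_mul_conj_deriv_le h _).trans (h1.trans ?_)
  nlinarith

/-- Near a smooth boundary point, the boundary is close to the tangent. -/
theorem eventually_abs_im_frontier_le {α : Fin q} {s : ℝ} (h : ContDiffAt ℝ 1 (T.γ α) s) {c : ℝ}
    (hc : 0 < c) : ∀ᶠ x in 𝓝 (T.γ α s), x ∈ frontier T.Ω →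
      |((x - T.γ α s) * (starRingEnd ℂ) (deriv (T.γ α) s)).im| ≤ c * ‖x - T.γ α s‖ := by
  rw [T.frontier_eq]
  have key : ∀ β, ∀ᶠ x in 𝓝 (T.γ α s), x ∈ Set.range (T.γ β) →
      |((x - T.γ α s) * (starRingEnd ℂ) (deriv (T.γ α) s)).im| ≤ c * ‖x - T.γ α s‖ := by
    intro β
    by_cases hβ : β = α
    · subst hβ
      obtain ⟨δ, hδ, hδ'⟩ := Metric.eventually_nhds_iff_ball.1 (T.eventually_abs_im_γ_le h hc)
      -- The rest of the curve: one period centred at `s` without a neighbourhood of `s`. Its image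
      -- is compact and misses the point, so it stays away from it.
      set K := Set.Icc (s - T.L β / 2) (s + T.L β / 2) \ Metric.ball s δ with hK
      have hKc : IsCompact K := isCompact_Icc.diff Metric.isOpen_ball
      have hsK : T.γ β s ∉ T.γ β '' K := by
        rintro ⟨t, ⟨ht, ht'⟩, hts⟩
        obtain ⟨n, hn⟩ := T.γ_eq_γ_iff.1 hts.symm
        have hL := T.L_pos β
        rw [zsmul_eq_mul] at hn
        have hn1 : (n : ℝ) < 1 := by
          by_contra hcon
          have : T.L β ≤ n * T.L β := le_mul_of_one_le_left hL.le (not_lt.1 hcon)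
          linarith [ht.2]
        have hn2 : (-1 : ℝ) < n := by
          by_contra hcon
          have : (n : ℝ) * T.L β ≤ -1 * T.L β := by gcongr; exact not_lt.1 hcon
          linarith [ht.1]
        have hn0 : n = 0 := by
          have h1 : n < 1 := by exact_mod_cast hn1
          have h2 : -1 < n := by exact_mod_cast hn2
          omega
        rw [hn0] at hn
        apply ht'
        rw [show t = s by simpa [sub_eq_zero] using hn]
        exact Metric.mem_ball_self hδ
      filter_upwards [(hKc.image (T.continuous β)).isClosed.isOpen_compl.mem_nhds hsK] with x hx
      rintro ⟨t, rfl⟩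
      obtain ⟨t', ht', htt'⟩ := (T.periodic β).exists_mem_Ico (T.L_pos β) t (s - T.L β / 2)
      rw [htt'] at hx ⊢
      by_cases hb : t' ∈ Metric.ball s δ
      · exact hδ' t' hb
      · exact absurd ⟨t', ⟨⟨ht'.1, by linarith [ht'.2]⟩, hb⟩, rfl⟩ hx
    · have hne : T.γ α s ∉ Set.range (T.γ β) := fun hmem =>
        Set.disjoint_left.1 (T.disjoint hβ) hmem ⟨s, rfl⟩
      filter_upwards [(T.isCompact_range_γ β).isClosed.isOpen_compl.mem_nhds hne] with x hx hx'
      exact absurd hx' hx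
  filter_upwards [eventually_all.2 key] with x hx hx'
  obtain ⟨β, hβ⟩ := Set.mem_iUnion.1 hx'
  exact hx β hβ

/-- Off the frontier the plane splits into the disjoint open sets `Ω` and the complement of its
closure. -/
theorem subset_Ω_of_isPreconnected {S : Set ℂ} (hS : IsPreconnected S)
    (hf : ∀ x ∈ S, x ∉ frontier T.Ω) (h : (S ∩ T.Ω).Nonempty) : S ⊆ T.Ω := by
  refine hS.subset_left_of_subset_union T.isOpen isClosed_closure.isOpen_compl
    (Set.disjoint_left.2 fun x hx hx' => hx' (subset_closure hx)) (fun x hx => ?_) h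
  by_contra hcon
  simp only [Set.mem_union, Set.mem_compl_iff, not_or, not_not] at hcon
  exact hf x hx ⟨hcon.2, by rw [T.isOpen.interior_eq]; exact hcon.1⟩

/-- Close to a smooth boundary point, all rays that point to the same side of the tangent are on the
same side of the boundary. -/
theorem eventually_mem_Ω_imp {α : Fin q} {s : ℝ} (h : ContDiffAt ℝ 1 (T.γ α) s) {a b : ℂ}
    (hab : 0 < (a * (starRingEnd ℂ) (deriv (T.γ α) s)).im *
      (b * (starRingEnd ℂ) (deriv (T.γ α) s)).im) :
    ∀ᶠ r : ℝ in 𝓝[>] 0, T.γ α s + r * a ∈ T.Ω → T.γ α s + r * b ∈ T.Ω := by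
  set e := deriv (T.γ α) s with he
  set A := (a * (starRingEnd ℂ) e).im with hA
  set B := (b * (starRingEnd ℂ) e).im with hB
  set m := min (A * A) (A * B) with hm
  have hA0 : A ≠ 0 := by rintro h0; rw [h0, zero_mul] at hab; exact lt_irrefl _ hab
  have hm0 : 0 < m := lt_min (mul_self_pos.2 hA0) hab
  set M := max ‖a‖ ‖b‖ + 1 with hM
  have hM0 : 0 < M := by positivity
  have hApos : 0 < |A| := abs_pos.2 hA0
  -- The cone is so narrow that no direction `w` on the segment from `a` to `b` lies in it: `A`
  -- times the normal part of `w` is at least `m`, and `‖w‖ < M`. The scaled segment thus misses the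
  -- frontier.
  have hcone := T.eventually_abs_im_frontier_le h (c := m / (2 * |A| * M)) (by positivity)
  obtain ⟨ε, hε, hball⟩ := Metric.eventually_nhds_iff_ball.1 hcone
  have hr : ∀ᶠ r : ℝ in 𝓝[>] 0, 0 < r ∧ r < ε / M :=
    Ioo_mem_nhdsGT (by positivity)
  filter_upwards [hr] with r hr ha
  have hseg : (fun w : ℂ => T.γ α s + r * w) '' segment ℝ a b ⊆ T.Ω := by
    refine T.subset_Ω_of_isPreconnected
      ((convex_segment a b).isPreconnected.image _ (by fun_prop)) ?_
      ⟨_, ⟨a, left_mem_segment ℝ a b, rfl⟩, ha⟩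
    rintro _ ⟨w, hw, rfl⟩ hf
    have hwM : ‖w‖ < M := by
      have : w ∈ Metric.closedBall (0 : ℂ) (max ‖a‖ ‖b‖) :=
        (convex_closedBall _ _).segment_subset (by simp) (by simp) hw
      have := mem_closedBall_zero_iff.1 this
      rw [hM]; linarith
    have hwA : m ≤ A * (w * (starRingEnd ℂ) e).im := by
      obtain ⟨x, y, hx, hy, hxy, rfl⟩ := hw
      have : (((x • a + y • b) * (starRingEnd ℂ) e)).im = x * A + y * B := by
        rw [add_mul, smul_mul_assoc, smul_mul_assoc, Complex.add_im, Complex.smul_im,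
          Complex.smul_im, smul_eq_mul, smul_eq_mul]
      rw [this]
      have h1 : x * m ≤ x * (A * A) := by gcongr; exact min_le_left _ _
      have h2 : y * m ≤ y * (A * B) := by gcongr; exact min_le_right _ _
      have h3 : m = x * m + y * m := by rw [← add_mul, hxy, one_mul]
      linarith
    have hnorm : ‖(r : ℂ) * w‖ = r * ‖w‖ := by
      rw [norm_mul, Complex.norm_real, Real.norm_of_nonneg hr.1.le]
    have hin := hball (T.γ α s + r * w) (by
      rw [Metric.mem_ball, dist_eq_norm, add_sub_cancel_left, hnorm]
      calc r * ‖w‖ ≤ r * M := by gcongr; exact hr.1.le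
        _ < ε := (lt_div_iff₀ hM0).1 hr.2) hf
    rw [add_sub_cancel_left, hnorm, mul_assoc, Complex.im_ofReal_mul,
      abs_mul, abs_of_pos hr.1] at hin
    have h1 : |(w * (starRingEnd ℂ) e).im| ≤ m / (2 * |A| * M) * ‖w‖ := by
      refine le_of_mul_le_mul_left ?_ hr.1
      calc _ ≤ _ := hin
        _ = _ := by ring
    have h2 : m ≤ |A| * |(w * (starRingEnd ℂ) e).im| := by
      rw [← abs_mul]; exact hwA.trans (le_abs_self _)
    have h3 : |A| * |(w * (starRingEnd ℂ) e).im| ≤ |A| * (m / (2 * |A| * M) * M) := by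
      gcongr
      exact h1.trans (by gcongr)
    have h4 : |A| * (m / (2 * |A| * M) * M) = m / 2 := by
      field_simp
    linarith
  exact hseg ⟨b, right_mem_segment ℝ a b, rfl⟩

/-- Comparison with the inner normal, along which `left_mem` gives points of `Ω`. -/
theorem eventually_mem_Ω {α : Fin q} {s : ℝ} (h : ContDiffAt ℝ 1 (T.γ α) s) {u : ℂ}
    (hu : 0 < (u * (starRingEnd ℂ) (deriv (T.γ α) s)).im) :
    ∀ᶠ r : ℝ in 𝓝[>] 0, T.γ α s + r * u ∈ T.Ω := by
  have h1 := T.eventually_mem_Ω_imp h (a := Complex.I * deriv (T.γ α) s) (b := u) (by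
    rw [mul_assoc, T.mul_conj_deriv_self h]
    simpa using hu)
  filter_upwards [h1, T.left_mem α s h] with r hr hr' using hr hr'

theorem eventually_notMem_Ω {α : Fin q} {s : ℝ} (h : ContDiffAt ℝ 1 (T.γ α) s) {u : ℂ}
    (hu : (u * (starRingEnd ℂ) (deriv (T.γ α) s)).im < 0) :
    ∀ᶠ r : ℝ in 𝓝[>] 0, T.γ α s + r * u ∉ T.Ω := by
  have h1 := T.eventually_mem_Ω_imp h (a := u) (b := -(Complex.I * deriv (T.γ α) s)) (by
    rw [neg_mul, mul_assoc, T.mul_conj_deriv_self h]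
    simpa using hu)
  filter_upwards [h1, T.right_notMem α s h] with r hr hr' hmem
  exact hr' (by simpa [sub_eq_add_neg] using hr hmem)

/-! ### Time reversal and the successor of a phase point -/

/-- The reversal of the velocity (followed by the reflection at the footpoint). -/
def flip (z : Fin q × ℝ × ℝ) : Fin q × ℝ × ℝ := (z.1, z.2.1, Real.pi - z.2.2)

theorem flip_flip (z : Fin q × ℝ × ℝ) : flip (flip z) = z := by
  simp [flip]

theorem direction_mul_conj {z : Fin q × ℝ × ℝ} (h : T.IsRegular z) (θ : ℝ) :
    T.direction z θ * (starRingEnd ℂ) (deriv (T.γ z.1) z.2.1) = Complex.exp (θ * Complex.I) := by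
  rw [direction, mul_assoc, T.mul_conj_deriv_self h, mul_one]

theorem norm_direction {z : Fin q × ℝ × ℝ} (h : T.IsRegular z) (θ : ℝ) :
    ‖T.direction z θ‖ = 1 := by
  rw [direction, norm_mul, T.unit_speed _ _ h, mul_one, Complex.norm_exp_ofReal_mul_I]

theorem direction_flip (z : Fin q × ℝ × ℝ) :
    T.direction (flip z) (flip z).2.2 = -T.direction z (-z.2.2) := by
  simp only [direction, flip]
  rw [← neg_mul]
  congr 1
  push_cast
  rw [sub_mul, Complex.exp_sub, Complex.exp_pi_mul_I, neg_mul, Complex.exp_neg]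
  ring

theorem direction_flip_neg (z : Fin q × ℝ × ℝ) :
    T.direction (flip z) (-(flip z).2.2) = -T.direction z z.2.2 := by
  have := T.direction_flip (flip z)
  rw [flip_flip] at this
  rw [this, neg_neg]

theorem flip_mem_phaseSpace {z : Fin q × ℝ × ℝ} : flip z ∈ T.phaseSpace ↔ z ∈ T.phaseSpace := by
  simp only [phaseSpace, flip, Set.mem_ofPred_eq, Set.mem_Ioo, sub_pos, sub_lt_self_iff]
  tauto

theorem γ_mem_frontier (α : Fin q) (s : ℝ) : T.γ α s ∈ frontier T.Ω := by
  rw [T.frontier_eq]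
  exact Set.mem_iUnion.2 ⟨α, s, rfl⟩

theorem γ_notMem_Ω (α : Fin q) (s : ℝ) : T.γ α s ∉ T.Ω := fun h => by
  have := (T.γ_mem_frontier α s).2
  rw [T.isOpen.interior_eq] at this
  exact this h

theorem eq_of_footpoint_eq {α β : Fin q} {s t : ℝ} (hs : s ∈ Set.Ico 0 (T.L α))
    (ht : t ∈ Set.Ico 0 (T.L β)) (h : T.γ α s = T.γ β t) : α = β ∧ s = t := by
  have hαβ : α = β := by
    by_contra hne
    exact Set.disjoint_left.1 (T.disjoint hne) ⟨s, rfl⟩ ⟨t, h.symm⟩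
  subst hαβ
  exact ⟨rfl, T.injOn α hs ht h⟩

variable {T}

theorem IsNext.flip {z w : Fin q × ℝ × ℝ} (h : T.IsNext z w) : T.IsNext (flip w) (flip z) := by
  obtain ⟨hz, hw, hzr, hwr, ⟨t, ht, hfoot, hin⟩, hdir⟩ := h
  refine ⟨T.flip_mem_phaseSpace.2 hw, T.flip_mem_phaseSpace.2 hz, hwr, hzr, ⟨t, ht, ?_, ?_⟩, ?_⟩
  · change T.footpoint z = T.footpoint w + _
    rw [direction_flip, ← hdir, hfoot]
    ring
  · intro r hr
    change T.footpoint w + _ ∈ _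
    rw [direction_flip, ← hdir, hfoot]
    have := hin (t - r) ⟨by linarith [hr.2], by linarith [hr.1]⟩
    push_cast at this
    convert this using 1
    ring
  · rw [direction_flip, direction_flip_neg, hdir]

/-- The chord runs inside `Ω` and ends off `Ω`, which fixes its length and hence the footpoint. The
angle is recovered as an argument in `(-π, π]`. -/
theorem IsNext.unique {z w w' : Fin q × ℝ × ℝ} (h : T.IsNext z w) (h' : T.IsNext z w') :
    w = w' := by
  obtain ⟨-, hw, hzr, hwr, ⟨t, ht, hfoot, hin⟩, hdir⟩ := h
  obtain ⟨-, hw', -, hwr', ⟨t', ht', hfoot', hin'⟩, hdir'⟩ := h'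
  have htt : t = t' := by
    rcases lt_trichotomy t t' with hlt | heq | hlt
    · exact absurd (hin' t ⟨ht, hlt⟩) (hfoot ▸ T.γ_notMem_Ω w.1 w.2.1 : _ ∉ T.Ω)
    · exact heq
    · exact absurd (hin t' ⟨ht', hlt⟩) (hfoot' ▸ T.γ_notMem_Ω w'.1 w'.2.1 : _ ∉ T.Ω)
  subst htt
  obtain ⟨h1, h2⟩ := T.eq_of_footpoint_eq hw.1 hw'.1 (hfoot.trans hfoot'.symm)
  obtain ⟨α, s, θ⟩ := w
  obtain ⟨α', s', θ'⟩ := w'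
  simp only at h1 h2
  subst h1 h2
  have h3 := T.direction_mul_conj hwr (-θ)
  have h4 := T.direction_mul_conj hwr' (-θ')
  have h5 : T.direction (α, s, θ) (-θ) = T.direction (α, s, θ') (-θ') := hdir.symm.trans hdir'
  rw [h5] at h3
  have h6 := h3.symm.trans h4
  have hθ : -θ ∈ Set.Ioc (-Real.pi) Real.pi :=
    ⟨by linarith [hw.2.2], by linarith [hw.2.1, Real.pi_pos]⟩
  have hθ' : -θ' ∈ Set.Ioc (-Real.pi) Real.pi :=
    ⟨by linarith [hw'.2.2], by linarith [hw'.2.1, Real.pi_pos]⟩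
  have h7 := congrArg Complex.arg h6
  have hpi : -Real.pi + 2 * Real.pi = Real.pi := by ring
  rw [Complex.arg_exp_mul_I, Complex.arg_exp_mul_I, (toIocMod_eq_self _).2 (by rwa [hpi]),
    (toIocMod_eq_self _).2 (by rwa [hpi])] at h7
  rw [neg_inj.1 h7]

variable (T)

/-- The ray of a smooth phase point meets the boundary. -/
theorem exists_exit {z : Fin q × ℝ × ℝ} (hz : z ∈ T.phaseSpace) (hr : T.IsRegular z) :
    ∃ t : ℝ, 0 < t ∧ T.footpoint z + t * T.direction z z.2.2 ∈ frontier T.Ω ∧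
      ∀ r ∈ Set.Ioo 0 t, T.footpoint z + r * T.direction z z.2.2 ∈ T.Ω := by
  set v := T.direction z z.2.2 with hv
  have hstart : ∀ᶠ r : ℝ in 𝓝[>] 0, T.footpoint z + r * v ∈ T.Ω := by
    refine T.eventually_mem_Ω hr ?_
    rw [hv, T.direction_mul_conj hr, Complex.exp_ofReal_mul_I_im]
    exact Real.sin_pos_of_mem_Ioo hz.2
  obtain ⟨ε, hε, hε'⟩ := mem_nhdsGT_iff_exists_Ioo_subset.1 hstart
  have hcont : Continuous fun r : ℝ => T.footpoint z + r * v := by fun_prop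
  -- Starting at `ε` excludes the footpoint itself, which is also off `Ω`; the infimum of `A` is
  -- then the first exit time.
  set A := Set.Ici ε ∩ (fun r : ℝ => T.footpoint z + r * v) ⁻¹' T.Ωᶜ with hA
  have hAc : IsClosed A := isClosed_Ici.inter (T.isOpen.isClosed_compl.preimage hcont)
  have hAb : BddBelow A := ⟨ε, fun r hr => hr.1⟩
  have hAne : A.Nonempty := by
    obtain ⟨R, hR⟩ := T.isBounded.subset_ball (T.footpoint z)
    refine ⟨max ε R, Set.mem_Ici.2 (le_max_left _ _), fun hmem => ?_⟩
    have := hR hmem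
    rw [Metric.mem_ball, dist_eq_norm, add_sub_cancel_left, norm_mul, hv, T.norm_direction hr,
      mul_one, Complex.norm_real] at this
    exact absurd ((le_abs_self _).trans_lt this) (not_lt.2 (le_max_right _ _))
  have htA := hAc.csInf_mem hAne hAb
  have hεt : ε ≤ sInf A := htA.1
  have hin : ∀ r ∈ Set.Ioo 0 (sInf A), T.footpoint z + r * v ∈ T.Ω := by
    intro r hr
    rcases lt_or_ge r ε with h | h
    · exact hε' ⟨hr.1, h⟩
    · by_contra hcon
      exact absurd (csInf_le hAb ⟨h, hcon⟩) (not_le.2 hr.2)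
  refine ⟨sInf A, lt_of_lt_of_le hε hεt, ⟨?_, ?_⟩, hin⟩
  · have hne : (0 : ℝ) ≠ sInf A := (lt_of_lt_of_le hε hεt).ne
    have hcl : sInf A ∈ closure (Set.Ioo 0 (sInf A)) := by
      rw [closure_Ioo hne]
      exact ⟨(lt_of_lt_of_le hε hεt).le, le_rfl⟩
    exact map_mem_closure (f := fun r : ℝ => T.footpoint z + r * v) hcont hcl hin
  · rw [T.isOpen.interior_eq]
    exact htA.2

/-- A smooth phase point without successor has a ray that runs into a corner or a tangency. -/
theorem exists_isNext_or_exists_singular {z : Fin q × ℝ × ℝ} (hz : z ∈ T.phaseSpace)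
    (hr : T.IsRegular z) : (∃ w, T.IsNext z w) ∨ ∃ (β : Fin q) (s t : ℝ), s ∈ Set.Ico 0 (T.L β) ∧
      T.γ β s = T.footpoint z + t * T.direction z z.2.2 ∧ (¬ ContDiffAt ℝ 1 (T.γ β) s ∨
        ContDiffAt ℝ 1 (T.γ β) s ∧
        (T.direction z z.2.2 * (starRingEnd ℂ) (deriv (T.γ β) s)).im = 0) := by
  obtain ⟨t, ht, hfr, hin⟩ := T.exists_exit hz hr
  set v := T.direction z z.2.2 with hv
  rw [T.frontier_eq] at hfr
  obtain ⟨β, s', hs'⟩ := Set.mem_iUnion.1 hfr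
  obtain ⟨s, hs, hss'⟩ := (T.periodic β).exists_mem_Ico₀ (T.L_pos β) s'
  rw [hss'] at hs'
  by_cases hreg : ContDiffAt ℝ 1 (T.γ β) s
  swap
  · exact Or.inr ⟨β, s, t, hs, hs', Or.inl hreg⟩
  -- The sign of the normal velocity at the exit point: negative is a transversal hit, with
  -- reflected angle `-arg u`; zero is a tangency; positive is impossible, since the ray would have
  -- arrived from outside `Ω`.
  rcases lt_trichotomy (v * (starRingEnd ℂ) (deriv (T.γ β) s)).im 0 with hlt | heq | hgt
  · left
    set u := v * (starRingEnd ℂ) (deriv (T.γ β) s) with hu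
    have hnu : ‖u‖ = 1 := by
      rw [hu, norm_mul, RCLike.norm_conj, T.unit_speed β s hreg, hv, T.norm_direction hr, mul_one]
    have hexp : Complex.exp (Complex.arg u * Complex.I) = u := by
      have := Complex.norm_mul_exp_arg_mul_I u
      rwa [hnu, Complex.ofReal_one, one_mul] at this
    refine ⟨(β, s, -Complex.arg u), hz, ⟨hs, ?_, ?_⟩, hr, hreg, ⟨t, ht, hs', hin⟩, ?_⟩
    · exact neg_pos.2 (Complex.arg_neg_iff.2 hlt)
    · exact neg_lt.1 (Complex.neg_pi_lt_arg u)
    · simp only [direction, neg_neg]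
      rw [hexp, hu, mul_assoc, mul_comm ((starRingEnd ℂ) _), T.mul_conj_deriv_self hreg, mul_one]
      rfl
  · exact Or.inr ⟨β, s, t, hs, hs', Or.inr ⟨hreg, heq⟩⟩
  · exfalso
    have h1 := T.eventually_notMem_Ω hreg (u := -v) (by rw [neg_mul, Complex.neg_im]; linarith)
    obtain ⟨r, hr1, hr2⟩ := (h1.and (Ioo_mem_nhdsGT ht)).exists
    apply hr1
    rw [hs']
    have := hin (t - r) ⟨by linarith [hr2.2], by linarith [hr2.1]⟩
    push_cast at this
    convert this using 1
    ring

/-! ### Measurability of the billiard map -/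

theorem measurable_footpoint : Measurable T.footpoint :=
  measurable_from_prod_countable_right fun α => ((T.continuous α).measurable.comp measurable_fst :)

/-- The positive unit tangent at the footpoint. -/
def tangent (z : Fin q × ℝ × ℝ) : ℂ := deriv (T.γ z.1) z.2.1

theorem measurable_tangent : Measurable T.tangent :=
  measurable_from_prod_countable_right fun α => ((measurable_deriv (T.γ α)).comp measurable_fst :)

theorem measurable_direction : Measurable fun z => T.direction z z.2.2 := by
  have := T.measurable_tangent
  unfold direction
  exact Measurable.mul (by fun_prop) this

theorem measurable_direction_neg : Measurable fun z => T.direction z (-z.2.2) := by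
  have := T.measurable_tangent
  unfold direction
  exact Measurable.mul (by fun_prop) this

theorem measurableSet_phaseSpace : MeasurableSet T.phaseSpace := by
  have h : Measurable fun z : Fin q × ℝ × ℝ => T.L z.1 :=
    (measurable_of_countable T.L).comp measurable_fst
  have h1 : Measurable fun z : Fin q × ℝ × ℝ => z.2.1 := by fun_prop
  have h2 : Measurable fun z : Fin q × ℝ × ℝ => z.2.2 := by fun_prop
  exact ((measurableSet_le measurable_const h1).inter (measurableSet_lt h1 h)).inter
    (h2 measurableSet_Ioo)

theorem isOpen_contDiffAt (α : Fin q) : IsOpen {s | ContDiffAt ℝ 1 (T.γ α) s} :=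
  isOpen_iff_mem_nhds.2 fun s (hs : ContDiffAt ℝ 1 (T.γ α) s) =>
    hs.eventually (by simp)

theorem measurableSet_isRegular : MeasurableSet {z | T.IsRegular z} := by
  have : {z | T.IsRegular z} = ⋃ α, {z : Fin q × ℝ × ℝ | z.1 = α} ∩
      (fun z => z.2.1) ⁻¹' {s | ContDiffAt ℝ 1 (T.γ α) s} := by
    ext z
    simp [IsRegular]
  rw [this]
  refine MeasurableSet.iUnion fun α => MeasurableSet.inter ?_ ?_
  · exact measurable_fst (measurableSet_singleton α)
  · exact (T.isOpen_contDiffAt α).measurableSet.preimage (by fun_prop)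

/-- Exhausting `(0, 1)` by compact intervals gives a countable intersection of sets that are open by
the tube lemma. -/
theorem measurableSet_openSegment_subset {U : Set ℂ} (hU : IsOpen U) :
    MeasurableSet {p : ℂ × ℂ | ∀ x ∈ Set.Ioo (0 : ℝ) 1, p.1 + x * (p.2 - p.1) ∈ U} := by
  have : {p : ℂ × ℂ | ∀ x ∈ Set.Ioo (0 : ℝ) 1, p.1 + x * (p.2 - p.1) ∈ U} =
      ⋂ n : ℕ, {p : ℂ × ℂ | ∀ x ∈ Set.Icc (1 / (n + 1) : ℝ) (1 - 1 / (n + 1)),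
        p.1 + x * (p.2 - p.1) ∈ U} := by
    ext p
    simp only [Set.mem_ofPred_eq, Set.mem_iInter]
    constructor
    · intro h n x hx
      have : (0 : ℝ) < 1 / (n + 1) := Nat.one_div_pos_of_nat
      exact h x ⟨by linarith [hx.1], by linarith [hx.2]⟩
    · intro h x hx
      obtain ⟨n, hn⟩ := exists_nat_one_div_lt (show 0 < min x (1 - x) from
        lt_min hx.1 (by linarith [hx.2]))
      have h1 := hn.trans_le (min_le_left _ _)
      have h2 := hn.trans_le (min_le_right _ _)
      exact h n x ⟨h1.le, by linarith⟩
  rw [this]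
  refine MeasurableSet.iInter fun n => IsOpen.measurableSet ?_
  refine isOpen_iff_mem_nhds.2 fun p hp => ?_
  refine isCompact_Icc.eventually_forall_of_forall_eventually (x₀ := p)
    (P := fun (p : ℂ × ℂ) (x : ℝ) => p.1 + x * (p.2 - p.1) ∈ U) fun x hx => ?_
  have hc : Continuous fun z : (ℂ × ℂ) × ℝ => z.1.1 + z.2 * (z.1.2 - z.1.1) := by fun_prop
  exact (hU.preimage hc).mem_nhds (hp x hx)

/-- Eliminating the flight time `t = ‖b - a‖` turns `IsNext` into a conjunction of Borel conditions.
-/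
theorem exists_segment_iff {a b v : ℂ} (hv : ‖v‖ = 1) (U : Set ℂ) :
    (∃ t : ℝ, 0 < t ∧ b = a + t * v ∧ ∀ r ∈ Set.Ioo 0 t, a + r * v ∈ U) ↔
      b ≠ a ∧ b - a = ‖b - a‖ * v ∧ ∀ x ∈ Set.Ioo (0 : ℝ) 1, a + x * (b - a) ∈ U := by
  constructor
  · rintro ⟨t, ht, rfl, h⟩
    have hn : ‖(t : ℂ) * v‖ = t := by
      rw [norm_mul, hv, mul_one, Complex.norm_real, Real.norm_of_nonneg ht.le]
    refine ⟨fun h0 => ?_, by rw [add_sub_cancel_left, hn], fun x hx => ?_⟩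
    · rw [add_eq_left] at h0
      rw [h0, norm_zero] at hn
      exact ht.ne hn
    · have := h (x * t) ⟨mul_pos hx.1 ht, by nlinarith [hx.2]⟩
      push_cast at this
      rwa [add_sub_cancel_left, ← mul_assoc]
  · rintro ⟨hne, hb, h⟩
    have hpos : 0 < ‖b - a‖ := norm_pos_iff.2 (sub_ne_zero.2 hne)
    refine ⟨‖b - a‖, hpos, by rw [← hb]; ring, fun r hr => ?_⟩
    have := h (r / ‖b - a‖) ⟨div_pos hr.1 hpos, (div_lt_one hpos).2 hr.2⟩
    have h0 : (‖b - a‖ : ℂ) ≠ 0 := by exact_mod_cast hpos.ne'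
    have h1 : ((r / ‖b - a‖ : ℝ) : ℂ) * (b - a) = r * v := by
      rw [Complex.ofReal_div, div_mul_eq_mul_div, div_eq_iff h0, mul_assoc, mul_comm v, ← hb]
    rwa [h1] at this

theorem measurableSet_isNext :
    MeasurableSet {p : (Fin q × ℝ × ℝ) × (Fin q × ℝ × ℝ) | T.IsNext p.1 p.2} := by
  have : {p : (Fin q × ℝ × ℝ) × (Fin q × ℝ × ℝ) | T.IsNext p.1 p.2} =
      {p | p.1 ∈ T.phaseSpace} ∩ {p | p.2 ∈ T.phaseSpace} ∩ {p | T.IsRegular p.1} ∩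
      {p | T.IsRegular p.2} ∩ {p | T.footpoint p.2 ≠ T.footpoint p.1} ∩
      {p | T.footpoint p.2 - T.footpoint p.1 =
        ‖T.footpoint p.2 - T.footpoint p.1‖ * T.direction p.1 p.1.2.2} ∩
      (fun p => (T.footpoint p.1, T.footpoint p.2)) ⁻¹'
        {p : ℂ × ℂ | ∀ x ∈ Set.Ioo (0 : ℝ) 1, p.1 + x * (p.2 - p.1) ∈ T.Ω} ∩
      {p | T.direction p.1 p.1.2.2 = T.direction p.2 (-p.2.2.2)} := by
    ext p
    simp only [Set.mem_inter_iff, Set.mem_preimage, Set.mem_ofPred_eq, IsNext]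
    constructor
    · rintro ⟨h1, h2, h3, h4, h5, h6⟩
      obtain ⟨h7, h8, h9⟩ := (exists_segment_iff (T.norm_direction h3 _) T.Ω).1 h5
      exact ⟨⟨⟨⟨⟨⟨⟨h1, h2⟩, h3⟩, h4⟩, h7⟩, h8⟩, h9⟩, h6⟩
    · rintro ⟨⟨⟨⟨⟨⟨⟨h1, h2⟩, h3⟩, h4⟩, h7⟩, h8⟩, h9⟩, h6⟩
      exact ⟨h1, h2, h3, h4, (exists_segment_iff (T.norm_direction h3 _) T.Ω).2 ⟨h7, h8, h9⟩, h6⟩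
  rw [this]
  have hf1 : Measurable fun p : (Fin q × ℝ × ℝ) × (Fin q × ℝ × ℝ) => T.footpoint p.1 :=
    T.measurable_footpoint.comp measurable_fst
  have hf2 : Measurable fun p : (Fin q × ℝ × ℝ) × (Fin q × ℝ × ℝ) => T.footpoint p.2 :=
    T.measurable_footpoint.comp measurable_snd
  have hd1 : Measurable fun p : (Fin q × ℝ × ℝ) × (Fin q × ℝ × ℝ) => T.direction p.1 p.1.2.2 :=
    T.measurable_direction.comp measurable_fst
  have hd2 : Measurable fun p : (Fin q × ℝ × ℝ) × (Fin q × ℝ × ℝ) =>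
      T.direction p.2 (-p.2.2.2) :=
    T.measurable_direction_neg.comp measurable_snd
  refine (((((((measurable_fst T.measurableSet_phaseSpace).inter
    (measurable_snd T.measurableSet_phaseSpace)).inter
    (measurable_fst T.measurableSet_isRegular)).inter
    (measurable_snd T.measurableSet_isRegular)).inter ?_).inter ?_).inter ?_).inter ?_
  · exact (measurableSet_eq_fun hf2 hf1).compl
  · exact measurableSet_eq_fun (hf2.sub hf1)
      ((Complex.measurable_ofReal.comp (hf2.sub hf1).norm).mul hd1)
  · exact (hf1.prodMk hf2) (measurableSet_openSegment_subset T.isOpen)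
  · exact measurableSet_eq_fun hd1 hd2

/-- The phase points that have a successor. -/
def domain : Set (Fin q × ℝ × ℝ) := {z | ∃ w, T.IsNext z w}

theorem isNext_billiardMap {z : Fin q × ℝ × ℝ} (h : z ∈ T.domain) :
    T.IsNext z (T.billiardMap z) := by
  have h' : ∃ w, T.IsNext z w := h
  rw [billiardMap, dif_pos h']
  exact h'.choose_spec

theorem billiardMap_of_notMem {z : Fin q × ℝ × ℝ} (h : z ∉ T.domain) : T.billiardMap z = z :=
  dif_neg h

variable {T} in
theorem IsNext.billiardMap_eq {z w : Fin q × ℝ × ℝ} (h : T.IsNext z w) : T.billiardMap z = w :=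
  (T.isNext_billiardMap ⟨w, h⟩).unique h

/-- The set is a projection of a Borel part of the graph of `IsNext`. Successors are unique, so the
projection is injective there and the Lusin–Souslin theorem applies. -/
theorem measurableSet_domain_inter_preimage {A : Set (Fin q × ℝ × ℝ)} (hA : MeasurableSet A) :
    MeasurableSet (T.domain ∩ T.billiardMap ⁻¹' A) := by
  have : T.domain ∩ T.billiardMap ⁻¹' A =
      Prod.fst '' ({p : (Fin q × ℝ × ℝ) × (Fin q × ℝ × ℝ) | T.IsNext p.1 p.2} ∩
        Prod.snd ⁻¹' A) := by
    ext z
    constructor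
    · rintro ⟨h1, h2⟩
      exact ⟨(z, T.billiardMap z), ⟨T.isNext_billiardMap h1, h2⟩, rfl⟩
    · rintro ⟨⟨z, w⟩, ⟨h1, h2⟩, rfl⟩
      exact ⟨⟨w, h1⟩, by rw [Set.mem_preimage, IsNext.billiardMap_eq h1]; exact h2⟩
  rw [this]
  refine (T.measurableSet_isNext.inter (measurable_snd hA)).image_of_measurable_injOn
    measurable_fst ?_
  rintro ⟨z, w⟩ ⟨h1, -⟩ ⟨z', w'⟩ ⟨h2, -⟩ (rfl : z = z')
  exact congrArg (Prod.mk z) (IsNext.unique h1 h2)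

theorem measurableSet_domain : MeasurableSet T.domain := by
  simpa using T.measurableSet_domain_inter_preimage MeasurableSet.univ

theorem measurable_billiardMap : Measurable T.billiardMap := by
  intro A hA
  have : T.billiardMap ⁻¹' A = (T.domain ∩ T.billiardMap ⁻¹' A) ∪ (T.domainᶜ ∩ A) := by
    ext z
    by_cases h : z ∈ T.domain
    · simp [h]
    · simp [h, T.billiardMap_of_notMem h]
  rw [this]
  exact (T.measurableSet_domain_inter_preimage hA).union (T.measurableSet_domain.compl.inter hA)

end BilliardTable

/-! ### Angles modulo `π` -/

section ModPi

/-- Reduction of an angle modulo `π` to `[0, π)`. -/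
def modPi (x : ℝ) : ℝ := toIcoMod Real.pi_pos 0 x

theorem modPi_mem (x : ℝ) : modPi x ∈ Set.Ico 0 Real.pi := by
  have := toIcoMod_mem_Ico Real.pi_pos 0 x
  rwa [zero_add] at this

theorem measurable_modPi : Measurable modPi := by
  have : modPi = fun x => Int.fract (x / Real.pi) * Real.pi :=
    funext fun x => toIcoMod_eq_fract_mul Real.pi_pos x
  rw [this]
  exact (measurable_fract.comp (measurable_id.div_const _)).mul_const _

theorem exists_modPi_eq (x : ℝ) : ∃ n : ℤ, modPi x = x - n * Real.pi :=
  ⟨toIcoDiv Real.pi_pos 0 x, by rw [modPi, toIcoMod, zsmul_eq_mul]⟩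

theorem modPi_eq_modPi_iff {x y : ℝ} : modPi x = modPi y ↔ ∃ n : ℤ, y - x = n * Real.pi := by
  simp only [modPi, toIcoMod_eq_toIcoMod, zsmul_eq_mul]

theorem modPi_of_mem {x : ℝ} (hx : x ∈ Set.Ico 0 Real.pi) : modPi x = x :=
  (toIcoMod_eq_self _).2 (by simpa using hx)

theorem modPi_modPi_add_sub (x τ : ℝ) : modPi (modPi (x + τ) - τ) = modPi x := by
  obtain ⟨n, hn⟩ := exists_modPi_eq (x + τ)
  rw [hn]
  exact modPi_eq_modPi_iff.2 ⟨n, by ring⟩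

theorem modPi_modPi_sub_add (x τ : ℝ) : modPi (modPi (x - τ) + τ) = modPi x := by
  have := modPi_modPi_add_sub x (-τ)
  simpa [sub_eq_add_neg] using this

theorem abs_sin_modPi (x : ℝ) : |Real.sin (modPi x)| = |Real.sin x| := by
  obtain ⟨n, hn⟩ := exists_modPi_eq x
  rw [hn, Real.sin_sub_int_mul_pi, abs_mul, abs_zpow, abs_neg, abs_one, one_zpow, one_mul]

theorem sin_modPi (x : ℝ) : Real.sin (modPi x) = |Real.sin x| := by
  rw [← abs_sin_modPi, abs_of_nonneg]
  exact Real.sin_nonneg_of_nonneg_of_le_pi (modPi_mem x).1 (modPi_mem x).2.le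

/-- Translation invariance of Lebesgue measure on the circle of length `π`. -/
theorem setLIntegral_modPi_sub (h : ℝ → ENNReal) (τ : ℝ) :
    ∫⁻ φ in Set.Ico 0 Real.pi, h (modPi (φ - τ)) = ∫⁻ θ in Set.Ico 0 Real.pi, h θ := by
  have hper : Function.Periodic (fun x => h (modPi x)) Real.pi := fun x => by
    simp only
    rw [modPi_eq_modPi_iff.2 (⟨-1, by push_cast; ring⟩ : ∃ n : ℤ, x - (x + Real.pi) = n * Real.pi)]
  have h1 := (measurePreserving_sub_right volume τ).setLIntegral_comp_preimage_emb
    (MeasurableEquiv.subRight τ).measurableEmbedding (fun x => h (modPi x))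
    (Set.Ico (-τ) (-τ + Real.pi))
  have h2 : (fun x => x - τ) ⁻¹' Set.Ico (-τ) (-τ + Real.pi) = Set.Ico 0 Real.pi := by
    ext x
    simp only [Set.mem_preimage, Set.mem_Ico]
    constructor <;> rintro ⟨h1, h2⟩ <;> constructor <;> linarith
  rw [h2] at h1
  have h3 := (isAddFundamentalDomain_Ioc Real.pi_pos (-τ)).setLIntegral_eq
    (isAddFundamentalDomain_Ioc Real.pi_pos 0) (fun x => h (modPi x)) hper.map_vadd_zmultiples
  rw [h1, setLIntegral_congr Ico_ae_eq_Ioc, h3, ← setLIntegral_congr Ico_ae_eq_Ioc, zero_add]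
  exact setLIntegral_congr_fun measurableSet_Ico fun x hx => by simp only [modPi_of_mem hx]

end ModPi

/-! ### The Liouville measure as area on the space of lines -/

namespace BilliardTable

variable {q : ℕ} (T : BilliardTable q)

theorem liouville_apply {E : Set (Fin q × ℝ × ℝ)} (hE : MeasurableSet E) :
    T.liouville E = ∑ α, ∫⁻ s in Set.Ico 0 (T.L α), ∫⁻ θ in Set.Ico 0 Real.pi,
      E.indicator (fun z => ENNReal.ofReal (Real.sin z.2.2)) (α, s, θ) := by
  have hm : Measurable fun z : Fin q × ℝ × ℝ => ENNReal.ofReal (Real.sin z.2.2) := by fun_prop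
  rw [liouville, withDensity_apply _ hE, ← lintegral_indicator hE,
    ← lintegral_indicator T.measurableSet_phaseSpace, lintegral_prod _
      ((hm.indicator hE).indicator T.measurableSet_phaseSpace).aemeasurable, lintegral_count,
    tsum_fintype]
  refine Finset.sum_congr rfl fun α _ => ?_
  have hmα : Measurable fun y : ℝ × ℝ => T.phaseSpace.indicator
      (E.indicator fun z => ENNReal.ofReal (Real.sin z.2.2)) (α, y) :=
    ((hm.indicator hE).indicator T.measurableSet_phaseSpace).comp measurable_prodMk_left
  rw [lintegral_prod _ hmα.aemeasurable, ← lintegral_indicator measurableSet_Ico]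
  refine lintegral_congr fun s => ?_
  by_cases hs : s ∈ Set.Ico 0 (T.L α)
  · rw [Set.indicator_of_mem hs, ← setLIntegral_congr Ioo_ae_eq_Ico,
      ← lintegral_indicator measurableSet_Ioo]
    refine lintegral_congr fun θ => ?_
    by_cases hθ : θ ∈ Set.Ioo 0 Real.pi
    · rw [Set.indicator_of_mem hθ,
        Set.indicator_of_mem (show (α, s, θ) ∈ T.phaseSpace from ⟨hs, hθ⟩)]
    · rw [Set.indicator_of_notMem hθ, Set.indicator_of_notMem fun h => hθ h.2]
  · rw [Set.indicator_of_notMem hs]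
    refine lintegral_eq_zero_of_ae_eq_zero (Eventually.of_forall fun θ => ?_)
    exact Set.indicator_of_notMem (fun h => hs h.1) _

/-- The angle, modulo `π`, of the line that carries the ray of a phase point. -/
def lineAngle (z : Fin q × ℝ × ℝ) : ℝ := modPi (z.2.2 + Complex.arg (T.tangent z))

/-- The signed distance from the origin of the line through `x` with angle `φ`. -/
def offset (φ : ℝ) (x : ℂ) : ℝ := (x * (starRingEnd ℂ) (Complex.exp (φ * Complex.I))).im

/-- The unoriented line that carries the ray of a phase point: its angle and its offset. -/
def line (z : Fin q × ℝ × ℝ) : ℝ × ℝ := (T.lineAngle z, offset (T.lineAngle z) (T.footpoint z))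

theorem measurable_lineAngle : Measurable T.lineAngle :=
  measurable_modPi.comp ((measurable_snd.comp measurable_snd).add
    (Complex.measurable_arg.comp T.measurable_tangent))

theorem continuous_offset : Continuous fun p : ℝ × ℂ => offset p.1 p.2 := by
  unfold offset
  fun_prop

theorem measurable_line : Measurable T.line :=
  T.measurable_lineAngle.prodMk
    (continuous_offset.measurable.comp (T.measurable_lineAngle.prodMk T.measurable_footpoint))

theorem hasDerivAt_offset_γ {α : Fin q} {s : ℝ} (h : ContDiffAt ℝ 1 (T.γ α) s) (φ : ℝ) :
    HasDerivAt (fun t => offset φ (T.γ α t)) (offset φ (deriv (T.γ α) s)) s := by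
  have h1 := (T.hasDerivAt_of_contDiffAt h).mul_const
    ((starRingEnd ℂ) (Complex.exp (φ * Complex.I)))
  exact Complex.imCLM.hasFDerivAt.comp_hasDerivAt s h1

theorem deriv_γ_eq_exp {α : Fin q} {s : ℝ} (h : ContDiffAt ℝ 1 (T.γ α) s) :
    deriv (T.γ α) s = Complex.exp (Complex.arg (deriv (T.γ α) s) * Complex.I) := by
  have := Complex.norm_mul_exp_arg_mul_I (deriv (T.γ α) s)
  rw [T.unit_speed α s h, Complex.ofReal_one, one_mul] at this
  exact this.symm

theorem offset_exp (φ ψ : ℝ) : offset φ (Complex.exp (ψ * Complex.I)) = Real.sin (ψ - φ) := by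
  rw [offset, ← Complex.exp_conj, ← Complex.exp_add, map_mul, Complex.conj_ofReal, Complex.conj_I,
    ← Complex.exp_ofReal_mul_I_im]
  congr 2
  push_cast
  ring

theorem offset_deriv_γ {α : Fin q} {s : ℝ} (h : ContDiffAt ℝ 1 (T.γ α) s) (φ : ℝ) :
    offset φ (deriv (T.γ α) s) = Real.sin (Complex.arg (deriv (T.γ α) s) - φ) := by
  conv_lhs => rw [T.deriv_γ_eq_exp h, offset_exp]

/-- In the coordinates on the space of lines, the Liouville measure is the area. -/
theorem liouville_eq_volume_line_image {α : Fin q} {E : Set (Fin q × ℝ × ℝ)} (hE : MeasurableSet E)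
    (hα : ∀ z ∈ E, z.1 = α) (hΦ : E ⊆ T.phaseSpace) (hreg : ∀ z ∈ E, T.IsRegular z)
    (hinj : Set.InjOn T.line E) : T.liouville E = volume (T.line '' E) := by
  set f : ℝ → ℝ → ENNReal := fun s θ =>
    E.indicator (fun z => ENNReal.ofReal (Real.sin z.2.2)) (α, s, θ) with hf
  set τ : ℝ → ℝ := fun s => Complex.arg (deriv (T.γ α) s) with hτ
  have hτm : Measurable τ := Complex.measurable_arg.comp (measurable_deriv _)
  have hm : Measurable fun z : Fin q × ℝ × ℝ => ENNReal.ofReal (Real.sin z.2.2) := by fun_prop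
  have h1 : T.liouville E = ∫⁻ s in Set.Ico 0 (T.L α), ∫⁻ θ in Set.Ico 0 Real.pi, f s θ := by
    rw [T.liouville_apply hE, Finset.sum_eq_single α]
    · intro β _ hβ
      refine lintegral_eq_zero_of_ae_eq_zero (Eventually.of_forall fun s => ?_)
      refine lintegral_eq_zero_of_ae_eq_zero (Eventually.of_forall fun θ => ?_)
      exact Set.indicator_of_notMem (fun h => hβ (hα _ h)) _
    · simp
  -- Replace the angle `θ` to the tangent by the angle `φ = θ + τ s` of the line, then exchange the
  -- integrals.
  have h2 : T.liouville E = ∫⁻ φ in Set.Ico 0 Real.pi, ∫⁻ s in Set.Ico 0 (T.L α),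
      f s (modPi (φ - τ s)) := by
    rw [h1, lintegral_lintegral_swap (f := fun φ s => f s (modPi (φ - τ s)))]
    · exact lintegral_congr fun s => (setLIntegral_modPi_sub (f s) (τ s)).symm
    · refine Measurable.aemeasurable ?_
      refine (hm.indicator hE).comp (measurable_const.prodMk (measurable_snd.prodMk ?_))
      exact measurable_modPi.comp (measurable_fst.sub (hτm.comp measurable_snd))
  have him : MeasurableSet (T.line '' E) := hE.image_of_measurable_injOn T.measurable_line hinj
  rw [h2, Measure.volume_eq_prod, Measure.prod_apply him, ← lintegral_indicator measurableSet_Ico]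
  refine lintegral_congr fun φ => ?_
  by_cases hφ : φ ∈ Set.Ico 0 Real.pi
  swap
  · rw [Set.indicator_of_notMem hφ, eq_comm]
    convert measure_empty (μ := (volume : Measure ℝ))
    refine Set.eq_empty_of_forall_notMem ?_
    rintro p ⟨z, -, hz⟩
    have hz' : T.lineAngle z = φ := congrArg Prod.fst hz
    exact hφ (by rw [← hz']; exact modPi_mem _)
  rw [Set.indicator_of_mem hφ]
  set S : Set ℝ := {s | (α, s, modPi (φ - τ s)) ∈ E} with hS
  have hSm : MeasurableSet S := by
    have : Measurable fun s => (α, s, modPi (φ - τ s)) :=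
      measurable_const.prodMk (measurable_id.prodMk
        (measurable_modPi.comp (measurable_const.sub hτm)))
    exact this hE
  have hline : ∀ s, T.line (α, s, modPi (φ - τ s)) = (φ, offset φ (T.γ α s)) := by
    intro s
    have : T.lineAngle (α, s, modPi (φ - τ s)) = φ := by
      rw [lineAngle]
      exact (modPi_modPi_sub_add φ (τ s)).trans (modPi_of_mem hφ)
    rw [line, this]
    rfl
  have hslice : Prod.mk φ ⁻¹' (T.line '' E) = (fun s => offset φ (T.γ α s)) '' S := by
    ext p
    constructor
    · rintro ⟨z, hz, hzp⟩
      obtain ⟨β, s, θ⟩ := z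
      obtain rfl : β = α := hα _ hz
      have hφz : T.lineAngle (β, s, θ) = φ := congrArg Prod.fst hzp
      have hθ : modPi (φ - τ s) = θ := by
        rw [← hφz, lineAngle]
        refine (modPi_modPi_add_sub θ (τ s)).trans (modPi_of_mem ?_)
        exact Set.Ioo_subset_Ico_self (hΦ hz).2
      refine ⟨s, ?_, ?_⟩
      · rw [hS, Set.mem_ofPred_eq, hθ]
        exact hz
      · have := congrArg Prod.snd hzp
        rw [line, hφz] at this
        exact this
    · rintro ⟨s, hs, rfl⟩
      exact ⟨_, hs, hline s⟩
  have hderiv : ∀ s ∈ S, HasDerivWithinAt (fun s => offset φ (T.γ α s))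
      (offset φ (deriv (T.γ α) s)) S s := fun s hs =>
    (T.hasDerivAt_offset_γ (hreg _ hs) φ).hasDerivWithinAt
  have hSinj : Set.InjOn (fun s => offset φ (T.γ α s)) S := by
    intro s hs t ht hst
    have := hinj hs ht (by rw [hline, hline]; exact congrArg (Prod.mk φ) hst)
    exact congrArg (fun z => z.2.1) this
  -- At fixed `φ` the offset is a function of `s` alone, and its derivative has absolute value `sin
  -- θ`, the Liouville density.
  have hvol := lintegral_image_eq_lintegral_abs_deriv_mul hSm hderiv hSinj fun _ => 1
  rw [setLIntegral_one] at hvol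
  rw [hslice, hvol, ← lintegral_indicator measurableSet_Ico, ← lintegral_indicator hSm]
  refine lintegral_congr fun s => ?_
  by_cases hs : s ∈ S
  · rw [Set.indicator_of_mem hs, Set.indicator_of_mem (hΦ hs).1, hf]
    simp only
    rw [Set.indicator_of_mem (by exact hs), mul_one, T.offset_deriv_γ (hreg _ hs), sin_modPi,
      ← abs_neg, ← Real.sin_neg, neg_sub]
  · rw [Set.indicator_of_notMem hs]
    refine Set.indicator_apply_eq_zero.2 fun _ => ?_
    exact Set.indicator_of_notMem (by exact hs) _

theorem offset_add (φ : ℝ) (x y : ℂ) : offset φ (x + y) = offset φ x + offset φ y := by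
  simp only [offset, add_mul, Complex.add_im]

theorem offset_ofReal_mul (φ r : ℝ) (x : ℂ) : offset φ (r * x) = r * offset φ x := by
  simp only [offset, mul_assoc, Complex.im_ofReal_mul]

theorem direction_eq_exp {z : Fin q × ℝ × ℝ} (h : T.IsRegular z) :
    T.direction z z.2.2 = Complex.exp ((z.2.2 + Complex.arg (T.tangent z) : ℝ) * Complex.I) := by
  rw [direction, T.deriv_γ_eq_exp h, ← Complex.exp_add, tangent]
  congr 1
  push_cast
  ring

theorem direction_eq_mul_exp {z : Fin q × ℝ × ℝ} (h : T.IsRegular z) :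
    ∃ ε : ℝ, ε ≠ 0 ∧ T.direction z z.2.2 = ε * Complex.exp (T.lineAngle z * Complex.I) := by
  obtain ⟨n, hn⟩ := exists_modPi_eq (z.2.2 + Complex.arg (T.tangent z))
  refine ⟨(-1) ^ n, zpow_ne_zero _ (by norm_num), ?_⟩
  have h1 : z.2.2 + Complex.arg (T.tangent z) = n * Real.pi + T.lineAngle z := by
    rw [lineAngle, hn]
    ring
  rw [T.direction_eq_exp h, h1]
  push_cast
  rw [add_mul, Complex.exp_add, mul_assoc, Complex.exp_int_mul, Complex.exp_pi_mul_I]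

theorem offset_lineAngle_direction {z : Fin q × ℝ × ℝ} (h : T.IsRegular z) :
    offset (T.lineAngle z) (T.direction z z.2.2) = 0 := by
  obtain ⟨ε, -, h⟩ := T.direction_eq_mul_exp h
  rw [h, offset_ofReal_mul, offset_exp, sub_self, Real.sin_zero, mul_zero]

theorem offset_eq_zero_of_im_eq_zero {z : Fin q × ℝ × ℝ} (h : T.IsRegular z) {e : ℂ}
    (he : (T.direction z z.2.2 * (starRingEnd ℂ) e).im = 0) : offset (T.lineAngle z) e = 0 := by
  obtain ⟨ε, hε, h⟩ := T.direction_eq_mul_exp h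
  rw [h, mul_assoc, Complex.im_ofReal_mul] at he
  have h2 := (mul_eq_zero.1 he).resolve_left hε
  rw [offset, ← neg_eq_zero, ← Complex.conj_im, map_mul, Complex.conj_conj, mul_comm]
  exact h2

variable {T} in
-- The reversed point has the opposite direction and its footpoint lies on the ray of `z`, so both
-- carry the same unoriented line.
theorem IsNext.line_flip {z w : Fin q × ℝ × ℝ} (h : T.IsNext z w) :
    T.line (BilliardTable.flip w) = T.line z := by
  obtain ⟨-, -, hzr, hwr, ⟨t, -, hfoot, -⟩, hdir⟩ := h
  have hwr' : T.IsRegular (BilliardTable.flip w) := hwr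
  have hangle : T.lineAngle (BilliardTable.flip w) = T.lineAngle z := by
    have h1 := T.direction_flip w
    rw [← hdir, T.direction_eq_exp hwr', T.direction_eq_exp hzr] at h1
    have h2 := offset_exp (z.2.2 + Complex.arg (T.tangent z))
      ((BilliardTable.flip w).2.2 + Complex.arg (T.tangent (BilliardTable.flip w)))
    rw [h1, ← neg_one_mul, ← Complex.ofReal_one, ← Complex.ofReal_neg, offset_ofReal_mul,
      offset_exp, sub_self, Real.sin_zero, mul_zero] at h2
    obtain ⟨n, hn⟩ := Real.sin_eq_zero_iff.1 h2.symm
    exact (modPi_eq_modPi_iff.2 ⟨n, hn.symm⟩).symm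
  rw [line, line, hangle]
  congr 1
  change offset _ (T.footpoint w) = _
  rw [hfoot, offset_add, offset_ofReal_mul, T.offset_lineAngle_direction hzr, mul_zero, add_zero]

theorem modPi_lineAngle_sub {z : Fin q × ℝ × ℝ} (hz : z ∈ T.phaseSpace) :
    modPi (T.lineAngle z - Complex.arg (T.tangent z)) = z.2.2 :=
  (modPi_modPi_add_sub _ _).trans (modPi_of_mem (Set.Ioo_subset_Ico_self hz.2))

theorem abs_offset_tangent {z : Fin q × ℝ × ℝ} (hz : z ∈ T.phaseSpace) (h : T.IsRegular z) :
    |offset (T.lineAngle z) (T.tangent z)| = Real.sin z.2.2 := by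
  rw [tangent, T.offset_deriv_γ h, ← abs_neg, ← Real.sin_neg, neg_sub, ← sin_modPi]
  exact congrArg Real.sin (T.modPi_lineAngle_sub hz)

/-- A piece of the phase space on which the line determines the phase point. -/
def piece (α : Fin q) (n : ℕ) (j : ℤ) : Set (Fin q × ℝ × ℝ) :=
  {z | z ∈ T.phaseSpace ∧ T.IsRegular z ∧ z.1 = α ∧
    z.2.1 ∈ Set.Ico (j / (n + 1) : ℝ) ((j + 1) / (n + 1)) ∧
    ∀ t, |t - z.2.1| < 1 / (n + 1) → |t - z.2.1| / (n + 1) ≤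
      |offset (T.lineAngle z) (T.γ α t) - offset (T.lineAngle z) (T.γ α z.2.1)|}

theorem measurableSet_piece (α : Fin q) (n : ℕ) (j : ℤ) : MeasurableSet (T.piece α n j) := by
  have h1 : Measurable fun z : Fin q × ℝ × ℝ => z.2.1 := by fun_prop
  have hcl : IsClosed {p : ℝ × ℝ | ∀ t, |t - p.2| < 1 / (n + 1) → |t - p.2| / (n + 1) ≤
      |offset p.1 (T.γ α t) - offset p.1 (T.γ α p.2)|} := by
    have : {p : ℝ × ℝ | ∀ t, |t - p.2| < 1 / (n + 1) → |t - p.2| / (n + 1) ≤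
        |offset p.1 (T.γ α t) - offset p.1 (T.γ α p.2)|} =
        ⋂ t, {p : ℝ × ℝ | |t - p.2| < 1 / (n + 1) → |t - p.2| / (n + 1) ≤
          |offset p.1 (T.γ α t) - offset p.1 (T.γ α p.2)|} := by
      ext p
      simp
    rw [this]
    refine isClosed_iInter fun t => isClosed_imp ?_ ?_
    · exact isOpen_lt (by fun_prop) continuous_const
    · have h2 : Continuous fun p : ℝ × ℝ => offset p.1 (T.γ α t) :=
        continuous_offset.comp (continuous_fst.prodMk continuous_const)
      have h3 : Continuous fun p : ℝ × ℝ => offset p.1 (T.γ α p.2) :=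
        continuous_offset.comp (continuous_fst.prodMk ((T.continuous α).comp continuous_snd))
      exact isClosed_le (by fun_prop) (by fun_prop)
  exact T.measurableSet_phaseSpace.inter (T.measurableSet_isRegular.inter
    ((measurable_fst (measurableSet_singleton α)).inter ((h1 measurableSet_Ico).inter
    ((T.measurable_lineAngle.prodMk h1) hcl.measurableSet))))

/-- Two parameters in a piece are less than `1 / (n + 1)` apart, so equal offsets and the lower
bound in `piece` force them to coincide; the line angle then gives back `θ`. -/
theorem injOn_line_piece (α : Fin q) (n : ℕ) (j : ℤ) : Set.InjOn T.line (T.piece α n j) := by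
  rintro z ⟨hz, hzr, hzα, hzj, hzt⟩ w ⟨hw, hwr, hwα, hwj, hwt⟩ h
  have hφ : T.lineAngle z = T.lineAngle w := congrArg Prod.fst h
  have hp : offset (T.lineAngle z) (T.footpoint z) = offset (T.lineAngle w) (T.footpoint w) :=
    congrArg Prod.snd h
  rw [footpoint, footpoint, hzα, hwα, ← hφ] at hp
  have hn : (0 : ℝ) < n + 1 := by positivity
  have hs : w.2.1 = z.2.1 := by
    have h1 := hzt w.2.1 (by
      have : ((j : ℝ) + 1) / (n + 1) = j / (n + 1) + 1 / (n + 1) := by ring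
      rw [abs_lt]
      constructor <;> linarith [hzj.1, hzj.2, hwj.1, hwj.2])
    rw [hp, sub_self, abs_zero, div_le_iff₀ hn, zero_mul] at h1
    exact sub_eq_zero.1 (abs_nonpos_iff.1 h1)
  have hθ := T.modPi_lineAngle_sub hz
  rw [hφ, tangent, hzα, ← hs, ← hwα] at hθ
  have hθ' := T.modPi_lineAngle_sub hw
  exact Prod.ext (hzα.trans hwα.symm) (Prod.ext hs.symm (hθ.symm.trans hθ'))

/-- The offset along the boundary has derivative `± sin θ ≠ 0` at the footpoint, hence grows at
least linearly near it. -/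
theorem exists_mem_piece {z : Fin q × ℝ × ℝ} (hz : z ∈ T.phaseSpace) (h : T.IsRegular z) :
    ∃ n j, z ∈ T.piece z.1 n j := by
  set g : ℝ → ℝ := fun t => offset (T.lineAngle z) (T.γ z.1 t) with hg
  set d := offset (T.lineAngle z) (T.tangent z) with hd
  have hd0 : 0 < |d| := by
    rw [hd, T.abs_offset_tangent hz h]
    exact Real.sin_pos_of_mem_Ioo hz.2
  have hder : HasDerivAt g d z.2.1 := T.hasDerivAt_offset_γ h _
  have h1 := (hasDerivAt_iff_isLittleO.1 hder).def (show 0 < |d| / 2 by positivity)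
  obtain ⟨δ, hδ, hball⟩ := Metric.eventually_nhds_iff_ball.1 h1
  obtain ⟨n, hn⟩ := exists_nat_one_div_lt (show 0 < min δ (|d| / 2) from lt_min hδ (by positivity))
  have hn' : (0 : ℝ) < n + 1 := by positivity
  refine ⟨n, ⌊z.2.1 * (n + 1)⌋, hz, h, rfl, ⟨?_, ?_⟩, fun t ht => ?_⟩
  · rw [div_le_iff₀ hn']
    exact Int.floor_le _
  · rw [lt_div_iff₀ hn']
    exact Int.lt_floor_add_one _
  · have h2 := hball t (by
      rw [Metric.mem_ball, Real.dist_eq]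
      exact ht.trans (hn.trans_le (min_le_left _ _)))
    simp only [Real.norm_eq_abs, smul_eq_mul] at h2
    have h3 := abs_sub_abs_le_abs_sub ((t - z.2.1) * d) (g t - g z.2.1)
    rw [abs_sub_comm (_ * d), abs_mul] at h3
    have h4 : |t - z.2.1| / (n + 1) ≤ |d| / 2 * |t - z.2.1| := by
      rw [div_eq_mul_one_div, mul_comm]
      exact mul_le_mul_of_nonneg_right (hn.trans_le (min_le_right _ _)).le (abs_nonneg _)
    change _ ≤ |g t - g z.2.1|
    linarith

/-! ### Almost every phase point has a successor -/

/-- The offsets of the lines with angle `φ` that run into a corner or a tangency form a null set. -/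
theorem volume_singular_offsets (φ : ℝ) :
    volume {p | ∃ (β : Fin q) (s : ℝ), s ∈ Set.Ico 0 (T.L β) ∧ offset φ (T.γ β s) = p ∧
      (¬ ContDiffAt ℝ 1 (T.γ β) s ∨
        ContDiffAt ℝ 1 (T.γ β) s ∧ offset φ (deriv (T.γ β) s) = 0)} = 0 := by
  have h1 : ∀ β, volume ((fun s => offset φ (T.γ β s)) ''
      {s ∈ Set.Ico 0 (T.L β) | ¬ ContDiffAt ℝ 1 (T.γ β) s}) = 0 := fun β =>
    ((T.finite_corners β).image _).measure_zero _
  have h2 : ∀ β, volume ((fun s => offset φ (T.γ β s)) ''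
      {s | ContDiffAt ℝ 1 (T.γ β) s ∧ offset φ (deriv (T.γ β) s) = 0}) = 0 := fun β => by
    -- Tangencies are critical points of the offset, so their offsets are critical values. In
    -- dimension one, differentiability suffices for these to be null.
    refine addHaar_image_eq_zero_of_det_fderivWithin_eq_zero volume
      (fun s hs => (T.hasDerivAt_offset_γ hs.1 φ).hasFDerivAt.hasFDerivWithinAt) fun s hs => ?_
    rw [hs.2, ContinuousLinearMap.det_toSpanSingleton]
  refine measure_mono_null ?_ (measure_iUnion_null fun β => measure_union_null (h1 β) (h2 β))
  rintro p ⟨β, s, hs, hp, h | h⟩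
  · exact Set.mem_iUnion.2 ⟨β, Or.inl ⟨s, ⟨hs, h⟩, hp⟩⟩
  · exact Set.mem_iUnion.2 ⟨β, Or.inr ⟨s, h, hp⟩⟩

/-- In line coordinates every slice at a fixed angle consists of singular offsets; Fubini concludes.
-/
theorem liouville_piece_diff_domain (α : Fin q) (n : ℕ) (j : ℤ) :
    T.liouville (T.piece α n j \ T.domain) = 0 := by
  have hm := (T.measurableSet_piece α n j).diff T.measurableSet_domain
  have hinj := (T.injOn_line_piece α n j).mono (Set.sdiff_subset (t := T.domain))
  rw [T.liouville_eq_volume_line_image hm (fun z hz => hz.1.2.2.1) (fun z hz => hz.1.1)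
    (fun z hz => hz.1.2.1) hinj, Measure.volume_eq_prod,
    Measure.measure_prod_null (hm.image_of_measurable_injOn T.measurable_line hinj)]
  refine Eventually.of_forall fun φ => measure_mono_null ?_ (T.volume_singular_offsets φ)
  rintro p ⟨z, ⟨⟨hz, hzr, -⟩, hzd⟩, hzp⟩
  have hφ : T.lineAngle z = φ := congrArg Prod.fst hzp
  have hp : offset (T.lineAngle z) (T.footpoint z) = p := congrArg Prod.snd hzp
  rcases T.exists_isNext_or_exists_singular hz hzr with h | ⟨β, s, t, hs, hst, h⟩
  · exact absurd h hzd
  · refine ⟨β, s, hs, ?_, h.imp_right fun h => ⟨h.1, ?_⟩⟩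
    · rw [hst, offset_add, offset_ofReal_mul, ← hφ, T.offset_lineAngle_direction hzr, mul_zero,
        add_zero, hp]
    · rw [← hφ]
      exact T.offset_eq_zero_of_im_eq_zero hzr h.2

theorem liouville_compl_phaseSpace : T.liouville T.phaseSpaceᶜ = 0 := by
  refine withDensity_absolutelyContinuous _ _ ?_
  rw [Measure.restrict_apply T.measurableSet_phaseSpace.compl, Set.compl_inter_self, measure_empty]

theorem ae_mem_phaseSpace : ∀ᵐ z ∂T.liouville, z ∈ T.phaseSpace :=
  T.liouville_compl_phaseSpace

theorem ae_isRegular : ∀ᵐ z ∂T.liouville, T.IsRegular z := by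
  change T.liouville {z | T.IsRegular z}ᶜ = 0
  rw [T.liouville_apply T.measurableSet_isRegular.compl]
  refine Finset.sum_eq_zero fun α _ => ?_
  refine lintegral_eq_zero_of_ae_eq_zero ?_
  have h := measure_eq_zero_iff_ae_notMem.1 ((T.finite_corners α).measure_zero volume)
  filter_upwards [ae_restrict_of_ae h, ae_restrict_mem measurableSet_Ico] with s hs hs'
  refine lintegral_eq_zero_of_ae_eq_zero (Eventually.of_forall fun θ => ?_)
  refine Set.indicator_of_notMem (s := {z | T.IsRegular z}ᶜ) (fun h => hs ⟨hs', h⟩) _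

/-- Almost every phase point has a successor. -/
theorem ae_mem_domain : ∀ᵐ z ∂T.liouville, z ∈ T.domain := by
  have h : ∀ᵐ z ∂T.liouville, ∀ α n j, z ∉ T.piece α n j \ T.domain :=
    ae_all_iff.2 fun α => ae_all_iff.2 fun n => ae_all_iff.2 fun j =>
      measure_eq_zero_iff_ae_notMem.1 (T.liouville_piece_diff_domain α n j)
  filter_upwards [h, T.ae_mem_phaseSpace, T.ae_isRegular] with z hz h1 h2
  obtain ⟨n, j, hnj⟩ := T.exists_mem_piece h1 h2
  by_contra hcon
  exact hz _ n j ⟨hnj, hcon⟩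

/-! ### Invariance of the Liouville measure -/

theorem measurable_flip : Measurable (BilliardTable.flip : Fin q × ℝ × ℝ → Fin q × ℝ × ℝ) := by
  unfold BilliardTable.flip
  fun_prop

theorem setLIntegral_pi_sub (h : ℝ → ENNReal) :
    ∫⁻ θ in Set.Ico 0 Real.pi, h (Real.pi - θ) = ∫⁻ θ in Set.Ico 0 Real.pi, h θ := by
  have h1 := (Measure.measurePreserving_sub_left volume Real.pi).setLIntegral_comp_preimage_emb
    (MeasurableEquiv.subLeft Real.pi).measurableEmbedding h (Set.Ioo 0 Real.pi)
  have h2 : (fun x => Real.pi - x) ⁻¹' Set.Ioo 0 Real.pi = Set.Ioo 0 Real.pi := by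
    ext x
    simp [and_comm]
  rw [h2] at h1
  rw [← setLIntegral_congr Ioo_ae_eq_Ico, h1, setLIntegral_congr Ioo_ae_eq_Ico]

theorem measurePreserving_flip :
    MeasurePreserving BilliardTable.flip T.liouville T.liouville := by
  refine ⟨measurable_flip, Measure.ext fun E hE => ?_⟩
  rw [Measure.map_apply measurable_flip hE, T.liouville_apply hE,
    T.liouville_apply (measurable_flip hE)]
  refine Finset.sum_congr rfl fun α _ => lintegral_congr fun s => ?_
  rw [← setLIntegral_pi_sub]
  refine lintegral_congr fun θ => ?_
  have hflip : BilliardTable.flip (α, s, Real.pi - θ) = (α, s, θ) := flip_flip (α, s, θ)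
  by_cases h : (α, s, θ) ∈ E
  · rw [Set.indicator_of_mem h,
      Set.indicator_of_mem (by rwa [Set.mem_preimage, hflip]), Real.sin_pi_sub]
  · rw [Set.indicator_of_notMem h, Set.indicator_of_notMem (by rwa [Set.mem_preimage, hflip])]

/-- The phase point at the end of the ray of `z` that looks back at `z`. -/
def lookBack (z : Fin q × ℝ × ℝ) : Fin q × ℝ × ℝ := BilliardTable.flip (T.billiardMap z)

theorem measurable_lookBack : Measurable T.lookBack :=
  measurable_flip.comp T.measurable_billiardMap

theorem billiardMap_lookBack {z : Fin q × ℝ × ℝ} (hz : z ∈ T.domain) :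
    T.billiardMap (T.lookBack z) = BilliardTable.flip z :=
  (T.isNext_billiardMap hz).flip.billiardMap_eq

theorem lookBack_lookBack {z : Fin q × ℝ × ℝ} (hz : z ∈ T.domain) :
    T.lookBack (T.lookBack z) = z := by
  rw [lookBack, T.billiardMap_lookBack hz, flip_flip]

theorem lookBack_mem_domain {z : Fin q × ℝ × ℝ} (hz : z ∈ T.domain) : T.lookBack z ∈ T.domain :=
  ⟨_, (T.isNext_billiardMap hz).flip⟩

theorem line_lookBack {z : Fin q × ℝ × ℝ} (hz : z ∈ T.domain) : T.line (T.lookBack z) = T.line z :=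
  (T.isNext_billiardMap hz).line_flip

/-- `lookBack` preserves lines and is an involution on the domain, so `E` and its preimage have the
same image in the space of lines, both injectively. Fixing `β` keeps the preimage on one component,
as the area formula requires. -/
theorem liouville_domain_inter_lookBack_preimage {α β : Fin q} {n : ℕ} {j : ℤ}
    {E : Set (Fin q × ℝ × ℝ)} (hE : MeasurableSet E)
    (hsub : E ⊆ T.piece α n j ∩ T.domain ∩ {z | (T.billiardMap z).1 = β}) :
    T.liouville (T.domain ∩ T.lookBack ⁻¹' E) = T.liouville E := by
  have hinj : Set.InjOn T.line E := (T.injOn_line_piece α n j).mono fun z hz => (hsub hz).1.1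
  have himage : T.line '' (T.domain ∩ T.lookBack ⁻¹' E) = T.line '' E := by
    ext p
    constructor
    · rintro ⟨z, ⟨hz, hzE⟩, rfl⟩
      exact ⟨_, hzE, T.line_lookBack hz⟩
    · rintro ⟨z, hz, rfl⟩
      have hzd := (hsub hz).1.2
      refine ⟨T.lookBack z, ⟨T.lookBack_mem_domain hzd, ?_⟩, T.line_lookBack hzd⟩
      rw [Set.mem_preimage, T.lookBack_lookBack hzd]
      exact hz
  rw [T.liouville_eq_volume_line_image hE (fun z hz => (hsub hz).1.1.2.2.1)
    (fun z hz => (hsub hz).1.1.1) (fun z hz => (hsub hz).1.1.2.1) hinj, ← himage]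
  refine T.liouville_eq_volume_line_image (α := β)
    (T.measurableSet_domain.inter (T.measurable_lookBack hE)) ?_ ?_ ?_ ?_
  · rintro z ⟨hz, hzE⟩
    have : (T.billiardMap (T.lookBack z)).1 = β := (hsub hzE).2
    rwa [T.billiardMap_lookBack hz] at this
  · exact fun z hz => (T.isNext_billiardMap hz.1).1
  · exact fun z hz => (T.isNext_billiardMap hz.1).2.2.1
  · rintro z ⟨hz, hzE⟩ w ⟨hw, hwE⟩ hzw
    have h1 := hinj hzE hwE (by rw [T.line_lookBack hz, T.line_lookBack hw, hzw])
    rw [← T.lookBack_lookBack hz, h1, T.lookBack_lookBack hw]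

theorem restrict_domain_liouville : T.liouville.restrict T.domain = T.liouville :=
  Measure.restrict_eq_self_of_ae_mem T.ae_mem_domain

theorem measurePreserving_lookBack :
    MeasurePreserving T.lookBack T.liouville T.liouville := by
  refine ⟨T.measurable_lookBack, ?_⟩
  -- A countable cover on whose members the measures are compared; `none` stands for the null set
  -- without successors, where the billiard map is the identity by convention.
  let U : Option (Fin q × Fin q × ℕ × ℤ) → Set (Fin q × ℝ × ℝ) := fun i => i.elim T.domainᶜ
    fun i => T.piece i.1 i.2.2.1 i.2.2.2 ∩ T.domain ∩ {z | (T.billiardMap z).1 = i.2.1}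
  have hUm : ∀ i, MeasurableSet (U i) := by
    rintro (_ | ⟨α, β, n, j⟩)
    · exact T.measurableSet_domain.compl
    · exact ((T.measurableSet_piece α n j).inter T.measurableSet_domain).inter
        ((measurable_fst.comp T.measurable_billiardMap) (measurableSet_singleton β))
  have hU : ⋃ i, U i = Set.univ := by
    refine Set.eq_univ_of_forall fun z => Set.mem_iUnion.2 ?_
    by_cases hz : z ∈ T.domain
    · have h := T.isNext_billiardMap hz
      obtain ⟨n, j, hnj⟩ := T.exists_mem_piece h.1 h.2.2.1
      exact ⟨some (z.1, (T.billiardMap z).1, n, j), ⟨hnj, hz⟩, rfl⟩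
    · exact ⟨none, hz⟩
  refine Measure.ext_of_iUnion_eq_univ hU fun i => Measure.ext fun A hA => ?_
  rw [Measure.restrict_apply hA, Measure.restrict_apply hA,
    Measure.map_apply T.measurable_lookBack (hA.inter (hUm i))]
  conv_lhs => rw [← T.restrict_domain_liouville,
    Measure.restrict_apply (T.measurable_lookBack (hA.inter (hUm i))), Set.inter_comm]
  obtain _ | ⟨α, β, n, j⟩ := i
  · have h1 : T.domain ∩ T.lookBack ⁻¹' (A ∩ U none) = ∅ :=
      Set.eq_empty_of_forall_notMem fun z hz => hz.2.2 (T.lookBack_mem_domain hz.1)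
    rw [h1, measure_empty]
    exact (measure_mono_null Set.inter_subset_right T.ae_mem_domain).symm
  · exact T.liouville_domain_inter_lookBack_preimage (hA.inter (hUm _)) Set.inter_subset_right

/-- The billiard map preserves the Liouville measure. -/
theorem measurePreserving_billiardMap :
    MeasurePreserving T.billiardMap T.liouville T.liouville := by
  have : T.billiardMap = BilliardTable.flip ∘ T.lookBack :=
    funext fun z => (flip_flip _).symm
  rw [this]
  exact T.measurePreserving_flip.comp T.measurePreserving_lookBack

theorem billiardMap_mem_phaseSpace {z : Fin q × ℝ × ℝ} (hz : z ∈ T.phaseSpace) :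
    T.billiardMap z ∈ T.phaseSpace := by
  by_cases h : z ∈ T.domain
  · exact (T.isNext_billiardMap h).2.1
  · rwa [T.billiardMap_of_notMem h]

theorem iterate_mem_phaseSpace {z : Fin q × ℝ × ℝ} (hz : z ∈ T.phaseSpace) (n : ℕ) :
    T.billiardMap^[n] z ∈ T.phaseSpace := by
  induction n with
  | zero => exact hz
  | succ n ih =>
    rw [Function.iterate_succ_apply']
    exact T.billiardMap_mem_phaseSpace ih

/-! ### Increments, consecutive visits and the gain -/

section Increment

theorem increment_nonneg {L s t : ℝ} (hs : s ∈ Set.Ico 0 L) (ht : t ∈ Set.Ico 0 L) :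
    0 ≤ increment L s t := by
  unfold increment
  split_ifs <;> linarith [hs.2, ht.1]

theorem increment_le {L s t : ℝ} (hs : s ∈ Set.Ico 0 L) (ht : t ∈ Set.Ico 0 L) :
    increment L s t ≤ L := by
  unfold increment
  split_ifs <;> linarith [hs.1, ht.2]

theorem increment_self (L s : ℝ) : increment L s s = 0 := by
  simp [increment]

/-- The two complementary arcs make up the curve. For `s = t` both increments are `0` instead of
summing to `L`, which is where the correction by closed returns originates. -/
theorem increment_add_increment {L s t : ℝ} (h : s ≠ t) :
    increment L s t + increment L t s = L := by
  rcases lt_or_gt_of_ne h with h | h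
  · rw [increment, increment, if_pos h.le, if_neg (not_le.2 h)]
    ring
  · rw [increment, increment, if_neg (not_le.2 h), if_pos h.le]
    ring

theorem measurable_increment (L : ℝ) : Measurable fun p : ℝ × ℝ => increment L p.1 p.2 :=
  Measurable.ite (measurableSet_le measurable_fst measurable_snd) (by fun_prop) (by fun_prop)

end Increment

section Visits

variable {α : Fin q} {z : Fin q × ℝ × ℝ} {k l m n : ℕ}

theorem visits_iterate : T.Visits α (T.billiardMap^[k] z) n ↔ T.Visits α z (k + n) := by
  rw [Visits, Visits, add_comm k, Function.iterate_add_apply]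

theorem consecutiveVisits_iterate :
    T.ConsecutiveVisits α (T.billiardMap^[k] z) 0 n ↔ T.ConsecutiveVisits α z k (k + n) := by
  simp only [ConsecutiveVisits, visits_iterate, add_zero]
  refine and_congr (by omega) (and_congr Iff.rfl (and_congr Iff.rfl ⟨fun h j h1 h2 => ?_,
    fun h j h1 h2 => h (k + j) (by omega) (by omega)⟩))
  have := h (j - k) (by omega) (by omega)
  rwa [Nat.add_sub_cancel' h1.le] at this

variable {T} in
theorem ConsecutiveVisits.unique (h : T.ConsecutiveVisits α z k l)
    (h' : T.ConsecutiveVisits α z k m) : l = m := by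
  rcases lt_trichotomy l m with hlt | heq | hlt
  · exact absurd h.2.2.1 (h'.2.2.2 l h.1 hlt)
  · exact heq
  · exact absurd h'.2.2.1 (h.2.2.2 m h'.1 hlt)

theorem measurableSet_visits (α : Fin q) (k : ℕ) : MeasurableSet {z | T.Visits α z k} :=
  (measurable_fst.comp (T.measurable_billiardMap.iterate k)) (measurableSet_singleton α)

theorem measurableSet_consecutiveVisits (α : Fin q) (k l : ℕ) :
    MeasurableSet {z | T.ConsecutiveVisits α z k l} := by
  have : {z | T.ConsecutiveVisits α z k l} = {_z | k < l} ∩ ({z | T.Visits α z k} ∩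
      ({z | T.Visits α z l} ∩ ⋂ j, ⋂ (_ : k < j), ⋂ (_ : j < l), {z | T.Visits α z j}ᶜ)) := by
    ext z
    simp [ConsecutiveVisits]
  rw [this]
  exact (MeasurableSet.const _).inter ((T.measurableSet_visits α k).inter
    ((T.measurableSet_visits α l).inter (MeasurableSet.iInter fun j => MeasurableSet.iInter fun _ =>
      MeasurableSet.iInter fun _ => (T.measurableSet_visits α j).compl)))

end Visits

/-- The increment of the arclength coordinate from time `0` to time `n`. -/
def incrementAt (α : Fin q) (n : ℕ) (z : Fin q × ℝ × ℝ) : ℝ :=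
  increment (T.L α) z.2.1 (T.billiardMap^[n] z).2.1

theorem measurable_incrementAt (α : Fin q) (n : ℕ) : Measurable (T.incrementAt α n) := by
  have h1 : Measurable fun z : Fin q × ℝ × ℝ => z.2.1 := by fun_prop
  exact (measurable_increment (T.L α)).comp
    (h1.prodMk (h1.comp (T.measurable_billiardMap.iterate n)))

open Classical in
/-- The increment of the arclength coordinate between a visit to `α` and the next one. -/
def gain (α : Fin q) (z : Fin q × ℝ × ℝ) : ℝ :=
  if h : z ∈ T.phaseSpace ∧ ∃ n, T.ConsecutiveVisits α z 0 n then
    T.incrementAt α h.2.choose z else 0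

variable {T} in
theorem ConsecutiveVisits.gain_eq {α : Fin q} {z : Fin q × ℝ × ℝ} {n : ℕ} (hz : z ∈ T.phaseSpace)
    (h : T.ConsecutiveVisits α z 0 n) : T.gain α z = T.incrementAt α n z := by
  have h' : z ∈ T.phaseSpace ∧ ∃ n, T.ConsecutiveVisits α z 0 n := ⟨hz, n, h⟩
  rw [gain, dif_pos h', h'.2.choose_spec.unique h]

variable {T} in
theorem ConsecutiveVisits.incrementAt_mem {α : Fin q} {z : Fin q × ℝ × ℝ} {n : ℕ}
    (hz : z ∈ T.phaseSpace) (h : T.ConsecutiveVisits α z 0 n) :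
    T.incrementAt α n z ∈ Set.Icc 0 (T.L α) := by
  have h1 := hz.1
  have h2 := (T.iterate_mem_phaseSpace hz n).1
  rw [show z.1 = α from h.2.1] at h1
  rw [show (T.billiardMap^[n] z).1 = α from h.2.2.1] at h2
  exact ⟨increment_nonneg h1 h2, increment_le h1 h2⟩

theorem gain_mem (α : Fin q) (z : Fin q × ℝ × ℝ) : T.gain α z ∈ Set.Icc 0 (T.L α) := by
  by_cases h : z ∈ T.phaseSpace ∧ ∃ n, T.ConsecutiveVisits α z 0 n
  · obtain ⟨hz, n, hn⟩ := h
    rw [hn.gain_eq hz]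
    exact hn.incrementAt_mem hz
  · rw [gain, dif_neg h]
    exact ⟨le_rfl, (T.L_pos α).le⟩

theorem abs_gain_le (α : Fin q) (z : Fin q × ℝ × ℝ) : |T.gain α z| ≤ T.L α := by
  rw [abs_of_nonneg (T.gain_mem α z).1]
  exact (T.gain_mem α z).2

theorem measurable_gain (α : Fin q) : Measurable (T.gain α) := by
  intro A hA
  set R : ℕ → Set (Fin q × ℝ × ℝ) := fun n => T.phaseSpace ∩ {z | T.ConsecutiveVisits α z 0 n}
    with hR
  have hRm : ∀ n, MeasurableSet (R n) := fun n =>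
    T.measurableSet_phaseSpace.inter (T.measurableSet_consecutiveVisits α 0 n)
  have : T.gain α ⁻¹' A = (⋃ n, R n ∩ T.incrementAt α n ⁻¹' A) ∪
      ((⋃ n, R n)ᶜ ∩ {_z | (0 : ℝ) ∈ A}) := by
    ext z
    by_cases h : z ∈ T.phaseSpace ∧ ∃ n, T.ConsecutiveVisits α z 0 n
    · obtain ⟨hz, n, hn⟩ := h
      have hmem : z ∈ ⋃ n, R n := Set.mem_iUnion.2 ⟨n, hz, hn⟩
      simp only [Set.mem_preimage, hn.gain_eq hz, Set.mem_union, Set.mem_inter_iff,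
        Set.mem_compl_iff, hmem, not_true_eq_false, false_and, or_false]
      constructor
      · exact fun h => Set.mem_iUnion.2 ⟨n, ⟨hz, hn⟩, h⟩
      · intro h
        obtain ⟨m, ⟨-, hm⟩, h⟩ := Set.mem_iUnion.1 h
        rwa [hn.unique hm]
    · have hmem : z ∉ ⋃ n, R n := fun hmem => by
        obtain ⟨n, hz, hn⟩ := Set.mem_iUnion.1 hmem
        exact h ⟨hz, n, hn⟩
      have hmem' : z ∉ ⋃ n, R n ∩ T.incrementAt α n ⁻¹' A := fun h' =>
        hmem (Set.iUnion_mono (fun n => Set.inter_subset_left) h')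
      simp only [Set.mem_preimage, gain, dif_neg h, Set.mem_union, hmem', false_or,
        Set.mem_inter_iff, Set.mem_compl_iff, hmem, not_false_eq_true, true_and, Set.mem_ofPred_eq]
  rw [this]
  exact (MeasurableSet.iUnion fun n => (hRm n).inter (T.measurable_incrementAt α n hA)).union
    ((MeasurableSet.iUnion hRm).compl.inter (MeasurableSet.const _))

/-! ### Comparison of the total increment with Birkhoff sums -/

section TotalIncrement

variable {α : Fin q} {z : Fin q × ℝ × ℝ}

theorem gain_iterate_eq {k l : ℕ} (hz : z ∈ T.phaseSpace) (h : T.ConsecutiveVisits α z k l) :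
    T.gain α (T.billiardMap^[k] z) =
      increment (T.L α) (T.billiardMap^[k] z).2.1 (T.billiardMap^[l] z).2.1 := by
  obtain ⟨m, rfl⟩ := Nat.exists_eq_add_of_lt h.1
  have h' := T.consecutiveVisits_iterate.2 (show T.ConsecutiveVisits α z k (k + (m + 1)) from h)
  rw [h'.gain_eq (T.iterate_mem_phaseSpace hz k), incrementAt, ← Function.iterate_add_apply,
    add_comm (m + 1) k, add_assoc]

theorem gain_iterate_eq_zero {k : ℕ} (h : ∀ l, ¬ T.ConsecutiveVisits α z k l) :
    T.gain α (T.billiardMap^[k] z) = 0 := by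
  rw [gain, dif_neg]
  rintro ⟨-, n, hn⟩
  exact h _ (T.consecutiveVisits_iterate.1 hn)

open Classical in
/-- The gain at time `k`, if the visit at time `k` is not followed by another one up to time `N`. -/
def pendingGain (α : Fin q) (z : Fin q × ℝ × ℝ) (N k : ℕ) : ℝ :=
  if ∃ l, N < l ∧ T.ConsecutiveVisits α z k l then T.gain α (T.billiardMap^[k] z) else 0

-- A visit has at most one next visit, so the inner sum is a single gain, absent if the next visit
-- falls after `N`.
open Classical in
theorem sum_consecutiveVisits (hz : z ∈ T.phaseSpace) (N k : ℕ) :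
    (∑ l ∈ Finset.range (N + 1), if T.ConsecutiveVisits α z k l then
      increment (T.L α) (T.billiardMap^[k] z).2.1 (T.billiardMap^[l] z).2.1 else 0) =
    T.gain α (T.billiardMap^[k] z) - T.pendingGain α z N k := by
  by_cases h : ∃ l, T.ConsecutiveVisits α z k l
  · obtain ⟨l, hl⟩ := h
    by_cases hlN : l ∈ Finset.range (N + 1)
    · rw [Finset.sum_eq_single_of_mem l hlN fun m _ hml => if_neg fun hm => hml (hm.unique hl),
        if_pos hl, ← T.gain_iterate_eq hz hl, pendingGain, if_neg, sub_zero]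
      rintro ⟨m, hm, hm'⟩
      rw [hl.unique hm', Finset.mem_range] at hlN
      omega
    · rw [Finset.sum_eq_zero fun m hm => if_neg fun hm' => hlN (hl.unique hm' ▸ hm), pendingGain,
        if_pos ⟨l, by rw [Finset.mem_range] at hlN; omega, hl⟩, sub_self]
  · have h' : ∀ l, ¬ T.ConsecutiveVisits α z k l := fun l hl => h ⟨l, hl⟩
    rw [Finset.sum_eq_zero fun m _ => if_neg (h' m), T.gain_iterate_eq_zero h', pendingGain,
      if_neg fun ⟨l, _, hl⟩ => h' l hl, sub_self]

/-- At most one term is nonzero: of two pending visits, the later would lie strictly between the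
earlier one and its successor. -/
theorem sum_pendingGain_mem (N : ℕ) :
    ∑ k ∈ Finset.range (N + 1), T.pendingGain α z N k ∈ Set.Icc 0 (T.L α) := by
  have hmem : ∀ k, T.pendingGain α z N k ∈ Set.Icc 0 (T.L α) := fun k => by
    unfold pendingGain
    split_ifs
    · exact T.gain_mem α _
    · exact ⟨le_rfl, (T.L_pos α).le⟩
  by_cases h : ∃ k ∈ Finset.range (N + 1), ∃ l, N < l ∧ T.ConsecutiveVisits α z k l
  · obtain ⟨k, hk, l, hNl, hl⟩ := h
    rw [Finset.sum_eq_single_of_mem k hk]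
    · exact hmem k
    · intro m hm hmk
      refine if_neg ?_
      rintro ⟨l', hNl', hl'⟩
      rw [Finset.mem_range] at hk hm
      rcases lt_or_gt_of_ne hmk with hlt | hlt
      · exact hl'.2.2.2 k hlt (by omega) hl.2.1
      · exact hl.2.2.2 m hlt (by omega) hl'.2.1
  · have h0 : ∑ k ∈ Finset.range (N + 1), T.pendingGain α z N k = 0 :=
      Finset.sum_eq_zero fun k hk => if_neg fun hl => h ⟨k, hk, hl⟩
    rw [h0]
    exact ⟨le_rfl, (T.L_pos α).le⟩

theorem abs_totalIncrement_sub_le (hz : z ∈ T.phaseSpace) (N : ℕ) :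
    |T.totalIncrement α z N - birkhoffSum T.billiardMap (T.gain α) N z| ≤ T.L α := by
  -- The extra start time `N` and the pending gain both contribute terms in `[0, L α]`, with
  -- opposite signs, so the error is at most `L α`.
  have h1 : T.totalIncrement α z N = birkhoffSum T.billiardMap (T.gain α) N z +
      T.gain α (T.billiardMap^[N] z) - ∑ k ∈ Finset.range (N + 1), T.pendingGain α z N k := by
    rw [totalIncrement, Finset.sum_congr rfl fun k _ => T.sum_consecutiveVisits hz N k,
      Finset.sum_sub_distrib, ← birkhoffSum_succ, birkhoffSum]
  have h2 := T.sum_pendingGain_mem (α := α) (z := z) N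
  have h3 := T.gain_mem α (T.billiardMap^[N] z)
  rw [h1, abs_le]
  constructor <;> linarith [h2.1, h2.2, h3.1, h3.2]

theorem hasFootpointGain_of_tendsto (hz : z ∈ T.phaseSpace) {u : ℝ}
    (h : Tendsto (fun n => birkhoffAverage ℝ T.billiardMap (T.gain α) n z) atTop (𝓝 u)) :
    T.HasFootpointGain α z u := by
  have h1 : Tendsto (fun N : ℕ => (T.totalIncrement α z N -
      birkhoffSum T.billiardMap (T.gain α) N z) / N) atTop (𝓝 0) := by
    refine squeeze_zero_norm (fun N => ?_) (tendsto_const_div_atTop_nhds_zero_nat (T.L α))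
    rw [norm_div, Real.norm_natCast, Real.norm_eq_abs]
    gcongr
    exact T.abs_totalIncrement_sub_le hz N
  have h2 := h.add h1
  rw [add_zero] at h2
  refine h2.congr fun N => ?_
  rw [birkhoffAverage, smul_eq_mul]
  ring

end TotalIncrement

/-! ### Total masses -/

theorem setLIntegral_sin : ∫⁻ θ in Set.Ico 0 Real.pi, ENNReal.ofReal (Real.sin θ) = 2 := by
  rw [← ofReal_integral_eq_lintegral_ofReal]
  · rw [integral_Ico_eq_integral_Ioc, ← intervalIntegral.integral_of_le Real.pi_pos.le,
      integral_sin, Real.cos_zero, Real.cos_pi]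
    norm_num
  · exact (Real.continuous_sin.integrableOn_Icc (a := 0) (b := Real.pi)).mono_set
      Set.Ico_subset_Icc_self
  · filter_upwards [ae_restrict_mem measurableSet_Ico] with θ hθ
    exact Real.sin_nonneg_of_nonneg_of_le_pi hθ.1 hθ.2.le

/-- The phase points on the boundary component `α`. -/
def component (α : Fin q) : Set (Fin q × ℝ × ℝ) := {z | z.1 = α}

theorem measurableSet_component (α : Fin q) : MeasurableSet (component α) :=
  measurable_fst (measurableSet_singleton α)

theorem liouville_component (α : Fin q) :
    T.liouville (component α) = ENNReal.ofReal (2 * T.L α) := by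
  rw [T.liouville_apply (measurableSet_component α), Finset.sum_eq_single α]
  · have : ∀ s θ : ℝ, (component α).indicator (fun z => ENNReal.ofReal (Real.sin z.2.2)) (α, s, θ) =
        ENNReal.ofReal (Real.sin θ) := fun s θ =>
      Set.indicator_of_mem (s := component α) (show (α, s, θ).1 = α from rfl) _
    simp_rw [this, setLIntegral_sin]
    rw [setLIntegral_const, Real.volume_Ico, sub_zero, ENNReal.ofReal_mul zero_le_two]
    simp
  · intro β _ hβ
    refine lintegral_eq_zero_of_ae_eq_zero (Eventually.of_forall fun s => ?_)
    refine lintegral_eq_zero_of_ae_eq_zero (Eventually.of_forall fun θ => ?_)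
    exact Set.indicator_of_notMem (s := component α) (a := (β, s, θ)) hβ _
  · simp

theorem liouville_univ : T.liouville Set.univ = ENNReal.ofReal (2 * T.perimeter) := by
  have h1 : (Set.univ : Set (Fin q × ℝ × ℝ)) = ⋃ α, component α := by
    ext z
    simp [component]
  have h2 : Pairwise (Function.onFun Disjoint (component (q := q))) := fun α β hαβ =>
    Set.disjoint_left.2 fun z hz hz' => hαβ (hz.symm.trans hz')
  rw [h1, measure_iUnion h2
    measurableSet_component, tsum_fintype, perimeter, Finset.mul_sum,
    ENNReal.ofReal_sum_of_nonneg fun α _ => by linarith [T.L_pos α]]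
  exact Finset.sum_congr rfl fun α _ => T.liouville_component α

theorem isFiniteMeasure_liouville : IsFiniteMeasure T.liouville :=
  ⟨by rw [T.liouville_univ]; exact ENNReal.ofReal_lt_top⟩

theorem perimeter_nonneg : 0 ≤ T.perimeter := Finset.sum_nonneg fun α _ => (T.L_pos α).le

theorem perimeter_pos (α : Fin q) : 0 < T.perimeter :=
  Finset.sum_pos (fun α _ => T.L_pos α) ⟨α, Finset.mem_univ α⟩

theorem liouville_real_univ : T.liouville.real Set.univ = 2 * T.perimeter := by
  rw [Measure.real, T.liouville_univ, ENNReal.toReal_ofReal (by linarith [T.perimeter_nonneg])]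

theorem liouville_real_component (α : Fin q) : T.liouville.real (component α) = 2 * T.L α := by
  rw [Measure.real, T.liouville_component, ENNReal.toReal_ofReal (by linarith [T.L_pos α])]

/-! ### Time reversal and the mean gain -/

theorem ae_forall_iterate_mem_domain :
    ∀ᵐ z ∂T.liouville, ∀ k, T.billiardMap^[k] z ∈ T.domain :=
  ae_all_iff.2 fun k =>
    (T.measurePreserving_billiardMap.iterate k).quasiMeasurePreserving.ae T.ae_mem_domain

/-- Reversibility: after a velocity reversal the orbit is run through backwards. -/
theorem iterate_flip_iterate {z : Fin q × ℝ × ℝ} {n : ℕ}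
    (h : ∀ k < n, T.billiardMap^[k] z ∈ T.domain) :
    T.billiardMap^[n] (BilliardTable.flip (T.billiardMap^[n] z)) = BilliardTable.flip z := by
  induction n with
  | zero => rfl
  | succ n ih =>
    rw [Function.iterate_succ_apply' _ n z, Function.iterate_succ_apply]
    exact (congrArg _ (T.billiardMap_lookBack (h n n.lt_succ_self))).trans
      (ih fun k hk => h k (hk.trans n.lt_succ_self))

theorem iterate_flip_iterate_of_le {z : Fin q × ℝ × ℝ} {k n : ℕ} (hkn : k ≤ n)
    (h : ∀ k, T.billiardMap^[k] z ∈ T.domain) :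
    T.billiardMap^[k] (BilliardTable.flip (T.billiardMap^[n] z)) =
      BilliardTable.flip (T.billiardMap^[n - k] z) := by
  have h1 := T.iterate_flip_iterate (z := T.billiardMap^[n - k] z) (n := k) fun j _ => by
    rw [← Function.iterate_add_apply]
    exact h _
  rwa [← Function.iterate_add_apply, Nat.add_sub_cancel' hkn] at h1

/-- The phase points that return to `α` for the first time at time `n`, at another footpoint. -/
def openReturns (α : Fin q) (n : ℕ) : Set (Fin q × ℝ × ℝ) :=
  {z | z ∈ T.phaseSpace ∧ T.ConsecutiveVisits α z 0 n ∧ z.2.1 ≠ (T.billiardMap^[n] z).2.1}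

theorem measurableSet_openReturns (α : Fin q) (n : ℕ) : MeasurableSet (T.openReturns α n) := by
  have h1 : Measurable fun z : Fin q × ℝ × ℝ => z.2.1 := by fun_prop
  exact T.measurableSet_phaseSpace.inter ((T.measurableSet_consecutiveVisits α 0 n).inter
    (measurableSet_eq_fun h1 (h1.comp (T.measurable_billiardMap.iterate n))).compl)

/-- The reversed orbit visits `α` at time `k` exactly when the original does at time `n - k`, so the
absence of intermediate visits is symmetric. -/
theorem flip_iterate_mem_openReturns {α : Fin q} {n : ℕ} {z : Fin q × ℝ × ℝ}
    (h : ∀ k, T.billiardMap^[k] z ∈ T.domain) (hz : z ∈ T.openReturns α n) :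
    BilliardTable.flip (T.billiardMap^[n] z) ∈ T.openReturns α n := by
  obtain ⟨hΦ, ⟨h1, h2, h3, h4⟩, h5⟩ := hz
  have hv : ∀ k ≤ n, T.Visits α (BilliardTable.flip (T.billiardMap^[n] z)) k ↔
      T.Visits α z (n - k) := fun k hk => by
    rw [Visits, T.iterate_flip_iterate_of_le hk h]
    rfl
  refine ⟨T.flip_mem_phaseSpace.2 (T.iterate_mem_phaseSpace hΦ n), ⟨h1, ?_, ?_, ?_⟩, ?_⟩
  · exact (hv 0 h1.le).2 h3
  · exact (hv n le_rfl).2 (by rwa [Nat.sub_self])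
  · intro j hj hjn
    rw [hv j hjn.le]
    exact h4 _ (by omega) (by omega)
  · rw [T.iterate_flip_iterate fun k _ => h k]
    exact h5.symm

theorem flip_iterate_flip_iterate {z : Fin q × ℝ × ℝ} (h : ∀ k, T.billiardMap^[k] z ∈ T.domain)
    (n : ℕ) : BilliardTable.flip
      (T.billiardMap^[n] (BilliardTable.flip (T.billiardMap^[n] z))) = z := by
  rw [T.iterate_flip_iterate fun k _ => h k, flip_flip]

/-- The map is almost everywhere an involution and sends the set into itself. -/
theorem preimage_openReturns_ae_eq (α : Fin q) (n : ℕ) :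
    (fun z => BilliardTable.flip (T.billiardMap^[n] z)) ⁻¹' T.openReturns α n =ᵐ[T.liouville]
      T.openReturns α n := by
  have hK : MeasurePreserving (fun z => BilliardTable.flip (T.billiardMap^[n] z))
      T.liouville T.liouville :=
    T.measurePreserving_flip.comp (T.measurePreserving_billiardMap.iterate n)
  filter_upwards [T.ae_forall_iterate_mem_domain,
    hK.quasiMeasurePreserving.ae T.ae_forall_iterate_mem_domain] with z h1 h2
  refine propext ⟨fun h => ?_, fun h => T.flip_iterate_mem_openReturns h1 h⟩
  have := T.flip_iterate_mem_openReturns h2 h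
  rwa [T.flip_iterate_flip_iterate h1] at this

theorem integrable_gain (α : Fin q) : Integrable (T.gain α) T.liouville :=
  have := T.isFiniteMeasure_liouville
  Integrable.of_bound (T.measurable_gain α).aestronglyMeasurable (T.L α)
    (Eventually.of_forall (T.abs_gain_le α))

/-- By time reversal, the gain is half the length of the boundary component on average. -/
theorem setIntegral_openReturns_gain (α : Fin q) (n : ℕ) :
    ∫ z in T.openReturns α n, T.gain α z ∂T.liouville =
      ∫ _z in T.openReturns α n, T.L α / 2 ∂T.liouville := by
  have := T.isFiniteMeasure_liouville
  set K : Fin q × ℝ × ℝ → Fin q × ℝ × ℝ := fun z => BilliardTable.flip (T.billiardMap^[n] z)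
    with hKdef
  have hK : MeasurePreserving K T.liouville T.liouville :=
    T.measurePreserving_flip.comp (T.measurePreserving_billiardMap.iterate n)
  have hm := T.measurableSet_openReturns α n
  have h1 : ∫ z in T.openReturns α n, T.gain α z ∂T.liouville =
      ∫ z in T.openReturns α n, T.gain α (K z) ∂T.liouville := by
    have h := setIntegral_map (μ := T.liouville) (g := K) hm
      (T.measurable_gain α).aestronglyMeasurable hK.measurable.aemeasurable
    rw [hK.map_eq] at h
    exact h.trans (setIntegral_congr_set (T.preimage_openReturns_ae_eq α n))
  -- Pointwise, the forward and the reversed gain add up to `L α`; by `h1` they have equal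
  -- integrals.
  have h2 : ∫ z in T.openReturns α n, (T.gain α z + T.gain α (K z)) ∂T.liouville =
      ∫ _z in T.openReturns α n, (T.L α / 2 + T.L α / 2) ∂T.liouville := by
    refine setIntegral_congr_ae hm ?_
    filter_upwards [T.ae_forall_iterate_mem_domain] with z hz hzn
    have hKz := T.flip_iterate_mem_openReturns hz hzn
    rw [hzn.2.1.gain_eq hzn.1, hKz.2.1.gain_eq hKz.1, incrementAt, incrementAt,
      T.iterate_flip_iterate fun k _ => hz k, add_halves]
    exact increment_add_increment hzn.2.2
  have hi := (T.integrable_gain α).integrableOn (s := T.openReturns α n)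
  have hi' : Integrable (fun z => T.gain α (K z)) (T.liouville.restrict (T.openReturns α n)) :=
    (hK.integrable_comp_of_integrable (T.integrable_gain α)).integrableOn
  rw [integral_add hi hi', ← h1, integral_add (integrable_const _) (integrable_const _)] at h2
  linarith

theorem measurableSet_closedReturns (α : Fin q) : MeasurableSet (T.closedReturns α) := by
  have h1 : Measurable fun z : Fin q × ℝ × ℝ => z.2.1 := by fun_prop
  have : T.closedReturns α = ⋃ n, {z | T.ConsecutiveVisits α z 0 n} ∩
      {z | (T.billiardMap^[n] z).2.1 = z.2.1} := by
    ext z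
    simp [closedReturns]
  rw [this]
  exact MeasurableSet.iUnion fun n => (T.measurableSet_consecutiveVisits α 0 n).inter
    (measurableSet_eq_fun (h1.comp (T.measurable_billiardMap.iterate n)) h1)

theorem closedReturns_subset_component (α : Fin q) : T.closedReturns α ⊆ component α := by
  rintro z ⟨n, hn, -⟩
  exact hn.2.1

/-- Poincaré recurrence for the finite invariant measure; the least positive return time is the next
visit. -/
theorem ae_exists_consecutiveVisits (α : Fin q) :
    ∀ᵐ z ∂T.liouville, z ∈ component α → ∃ n, T.ConsecutiveVisits α z 0 n := by
  have := T.isFiniteMeasure_liouville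
  classical
  filter_upwards [T.measurePreserving_billiardMap.conservative.ae_mem_imp_frequently_image_mem
    (measurableSet_component α).nullMeasurableSet] with z hz hzα
  have hex : ∃ n, 0 < n ∧ T.Visits α z n := by
    obtain ⟨n, h1, h2⟩ := ((hz hzα).and_eventually (eventually_gt_atTop 0)).exists
    exact ⟨n, h2, h1⟩
  exact ⟨Nat.find hex, (Nat.find_spec hex).1, hzα, (Nat.find_spec hex).2,
    fun j hj hj' hv => Nat.find_min hex hj' ⟨hj, hv⟩⟩

theorem iUnion_openReturns_ae_eq (α : Fin q) :
    (⋃ n, T.openReturns α n : Set _) =ᵐ[T.liouville]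
      (component α \ T.closedReturns α : Set (Fin q × ℝ × ℝ)) := by
  filter_upwards [T.ae_exists_consecutiveVisits α, T.ae_mem_phaseSpace] with z hz hΦ
  refine propext ⟨fun h => ?_, fun h => ?_⟩
  · obtain ⟨n, -, h1, h2⟩ := Set.mem_iUnion.1 h
    refine ⟨h1.2.1, ?_⟩
    rintro ⟨m, h3, h4⟩
    rw [h1.unique h3] at h2
    exact h2 h4.symm
  · obtain ⟨n, hn⟩ := hz h.1
    exact Set.mem_iUnion.2 ⟨n, hΦ, hn, fun heq => h.2 ⟨n, hn, heq.symm⟩⟩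

theorem gain_eq_zero_of_notMem {α : Fin q} {z : Fin q × ℝ × ℝ} (h : z ∉ ⋃ n, T.openReturns α n) :
    T.gain α z = 0 := by
  by_cases h' : z ∈ T.phaseSpace ∧ ∃ n, T.ConsecutiveVisits α z 0 n
  · obtain ⟨hz, n, hn⟩ := h'
    rw [hn.gain_eq hz, incrementAt]
    by_cases heq : z.2.1 = (T.billiardMap^[n] z).2.1
    · rw [← heq, increment_self]
    · exact (h (Set.mem_iUnion.2 ⟨n, hz, hn, heq⟩)).elim
  · rw [gain, dif_neg h']

theorem integral_gain (α : Fin q) : ∫ z, T.gain α z ∂T.liouville =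
    T.L α ^ 2 - T.L α / 2 * T.liouville.real (T.closedReturns α) := by
  have := T.isFiniteMeasure_liouville
  have hd : Pairwise (Function.onFun Disjoint (T.openReturns α)) := fun m n hmn =>
    Set.disjoint_left.2 fun z hz hz' => hmn (hz.2.1.unique hz'.2.1)
  have h1 := hasSum_integral_iUnion (T.measurableSet_openReturns α) hd
    ((T.integrable_gain α).integrableOn)
  have h2 := hasSum_integral_iUnion (T.measurableSet_openReturns α) hd
    (integrable_const (T.L α / 2) : Integrable _ (T.liouville.restrict _))
  -- Summing over the return time `n`, the gain has the same integral over all open returns as the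
  -- constant `L α / 2`.
  simp_rw [T.setIntegral_openReturns_gain α] at h1
  have h3 := h1.unique h2
  rw [setIntegral_eq_integral_of_forall_compl_eq_zero fun z hz => T.gain_eq_zero_of_notMem hz,
    setIntegral_const, measureReal_congr (T.iUnion_openReturns_ae_eq α),
    measureReal_sdiff (T.closedReturns_subset_component α) (T.measurableSet_closedReturns α),
    T.liouville_real_component, smul_eq_mul] at h3
  rw [h3]
  ring

/-! ### The footpoint gain and the rotation vector -/

theorem ae_tendsto_birkhoffAverage_gain : ∀ᵐ z ∂T.liouville, ∀ α, ∃ u,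
    Tendsto (fun n => birkhoffAverage ℝ T.billiardMap (T.gain α) n z) atTop (𝓝 u) :=
  have := T.isFiniteMeasure_liouville
  ae_all_iff.2 fun α => ae_exists_tendsto_birkhoffAverage T.measurePreserving_billiardMap
    (T.measurable_gain α) (T.abs_gain_le α)

theorem ae_exists_hasFootpointGain : ∀ᵐ z ∂T.liouville, ∀ α, ∃ u, T.HasFootpointGain α z u := by
  filter_upwards [T.ae_tendsto_birkhoffAverage_gain, T.ae_mem_phaseSpace] with z hz hΦ α
  obtain ⟨u, hu⟩ := hz α
  exact ⟨u, T.hasFootpointGain_of_tendsto hΦ hu⟩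

theorem footpointGain_eq {z : Fin q × ℝ × ℝ} {α : Fin q} {u : ℝ} (hz : z ∈ T.phaseSpace)
    (h : Tendsto (fun n => birkhoffAverage ℝ T.billiardMap (T.gain α) n z) atTop (𝓝 u)) :
    T.footpointGain z α = u :=
  (T.hasFootpointGain_of_tendsto hz h).limUnder_eq

theorem ae_tendsto_footpointGain (α : Fin q) : ∀ᵐ z ∂T.liouville,
    Tendsto (fun n => birkhoffAverage ℝ T.billiardMap (T.gain α) n z) atTop
      (𝓝 (T.footpointGain z α)) := by
  filter_upwards [T.ae_tendsto_birkhoffAverage_gain, T.ae_mem_phaseSpace] with z hz hΦ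
  obtain ⟨u, hu⟩ := hz α
  rwa [T.footpointGain_eq hΦ hu]

theorem integrable_footpointGain_apply (α : Fin q) :
    Integrable (fun z => T.footpointGain z α) T.liouville :=
  have := T.isFiniteMeasure_liouville
  (integrable_and_integral_eq_of_tendsto_birkhoffAverage T.measurePreserving_billiardMap
    (T.measurable_gain α) (T.abs_gain_le α) (T.ae_tendsto_footpointGain α)).1

theorem integral_footpointGain (α : Fin q) : ∫ z, T.footpointGain z α ∂T.liouville =
    T.L α ^ 2 - T.L α / 2 * T.liouville.real (T.closedReturns α) :=
  have := T.isFiniteMeasure_liouville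
  (integrable_and_integral_eq_of_tendsto_birkhoffAverage T.measurePreserving_billiardMap
    (T.measurable_gain α) (T.abs_gain_le α) (T.ae_tendsto_footpointGain α)).2.trans
    (T.integral_gain α)

/-- Birkhoff averages of a bounded function at `z` and at its image have vanishing difference; this
invariance makes the gain constant in the ergodic case. -/
theorem footpointGain_comp_ae_eq (α : Fin q) :
    (fun z => T.footpointGain z α) ∘ T.billiardMap =ᵐ[T.liouville]
      fun z => T.footpointGain z α := by
  filter_upwards [T.ae_tendsto_footpointGain α, T.ae_mem_phaseSpace] with z hz hΦ
  refine T.footpointGain_eq (T.billiardMap_mem_phaseSpace hΦ) ?_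
  have := (tendsto_birkhoffAverage_comp_sub (T := T.billiardMap) (T.abs_gain_le α) z).add hz
  simpa using this

theorem integral_rotationVector_apply (α : Fin q) :
    (∫ z, T.rotationVector z ∂T.liouville) α =
      (∫ z, T.footpointGain z α ∂T.liouville) / T.L α := by
  have h : ∀ α, Integrable (fun z => T.rotationVector z α) T.liouville := fun α =>
    (T.integrable_footpointGain_apply α).div_const (T.L α)
  rw [eval_integral h]
  exact integral_div _ _

/-- For an ergodic billiard, the footpoint gain is almost surely equal to its mean. -/
theorem ae_footpointGain_eq_of_isErgodic (h : T.IsErgodic) (α : Fin q) : ∀ᵐ z ∂T.liouville,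
    T.footpointGain z α = (∫ w, T.footpointGain w α ∂T.liouville) / (2 * T.perimeter) := by
  have := T.isFiniteMeasure_liouville
  have he : Ergodic T.billiardMap T.liouville := ⟨T.measurePreserving_billiardMap, h⟩
  obtain ⟨c, hc⟩ := he.ae_eq_const_of_ae_eq_comp_ae (T.integrable_footpointGain_apply α).1
    (T.footpointGain_comp_ae_eq α)
  have hint : ∫ w, T.footpointGain w α ∂T.liouville = 2 * T.perimeter * c := by
    rw [integral_congr_ae hc]
    simp [T.liouville_real_univ]
  filter_upwards [hc] with z hz
  have hp := T.perimeter_pos α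
  rw [hz, hint]
  simp only [Function.const_apply]
  field_simp

end BilliardTable

end

theorem mainTheorem2 {q : ℕ} (T : BilliardTable q) :
    (∀ᵐ z ∂T.liouville, ∀ α, ∃ u, T.HasFootpointGain α z u) ∧
    Integrable T.footpointGain T.liouville ∧
    (∀ α, ∫ z, T.footpointGain z α ∂T.liouville =
      T.L α ^ 2 - T.L α / 2 * T.liouville.real (T.closedReturns α)) ∧
    ((∀ α, T.liouville (T.closedReturns α) = 0) →
      (∀ α, ∫ z, T.footpointGain z α ∂T.liouville = T.L α ^ 2) ∧
      (T.liouville.real Set.univ)⁻¹ • ∫ z, T.rotationVector z ∂T.liouville =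
        (fun α => 1 / 2 * (T.L α / T.perimeter)) ∧
      (T.IsErgodic → ∀ᵐ z ∂T.liouville,
        T.rotationVector z = fun α => 1 / 2 * (T.L α / T.perimeter))) := by
  refine ⟨T.ae_exists_hasFootpointGain, Integrable.of_eval T.integrable_footpointGain_apply,
    T.integral_footpointGain, fun h0 => ?_⟩
  have hint : ∀ α, ∫ z, T.footpointGain z α ∂T.liouville = T.L α ^ 2 := fun α => by
    rw [T.integral_footpointGain, Measure.real, h0 α, ENNReal.toReal_zero, mul_zero, sub_zero]
  refine ⟨hint, ?_, fun he => ?_⟩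
  · ext α
    have hL := T.L_pos α
    have hp := T.perimeter_pos α
    rw [Pi.smul_apply, T.integral_rotationVector_apply, hint, T.liouville_real_univ, smul_eq_mul]
    field_simp
  · filter_upwards [ae_all_iff.2 (T.ae_footpointGain_eq_of_isErgodic he)] with z hz
    ext α
    have hL := T.L_pos α
    have hp := T.perimeter_pos α
    rw [BilliardTable.rotationVector, hz α, hint]
    field_simp
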